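/- Let $G$ be a finite-dimensional real Lie group with Lie algebra $\mathfrak g$ and identity $e$, and write $L_g$, $R_g$ for the maps induced on bivectors by left and right translation by $g\in G$. Let $(G,\pi)$ be a Poisson–Lie group: $\pi$ is a smooth field of bivectors on $G$ whose bracket $\{f_1,f_2\}=(df_1\wedge df_2)(\pi)$ satisfies the Jacobi identity, and $\pi(gh)=L_g\pi(h)+R_h\pi(g)$ for all $g,h\in G$. For a closed subgroup $H$ of $G$ with Lie algebra $\mathfrak h$, let $\mathfrak h\wedge\mathfrak g\subset\mathfrak g\wedge\mathfrak g=\wedge^2\mathfrak g$ be the span of all $x\wedge y$ with $x\in\mathfrak h$, $y\in\mathfrak g$, and call $H$ coisotropic with respect to a field of bivectors $\rho$ on $G$ if $$\rho(gh)-R_h(\rho(g))\in L_{gh}(\mathfrak h\wedge\mathfrak g)\qquad\text{for all } g\in G,\ h\in H.$$ Let $H$ be a closed subgroup of $G$ that is coisotropic with respect to $\pi$, let $\sigma\in G$, and put $\pi_\sigma(g)=R_\sigma(\pi(g\sigma^{-1}))$ and $X_\sigma=R_\sigma(\pi(\sigma^{-1}))=\pi_\sigma(e)\in\mathfrak g\wedge\mathfrak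 g$. (i) If $H$ is coisotropic with respect to $\pi_\sigma$, then $\operatorname{ad}_{\mathfrak h}(X_\sigma)\subset\mathfrak h\wedge\mathfrak g$, that is, $\operatorname{ad}_x(X_\sigma)\in\mathfrak h\wedge\mathfrak g$ for all $x\in\mathfrak h$, where $\operatorname{ad}_x(u\wedge v)=[x,u]\wedge v+u\wedge[x,v]$. (ii) If moreover $H$ is connected, then $H$ is coisotropic with respect to $\pi_\sigma$ if and only if $\operatorname{ad}_{\mathfrak h}(X_\sigma)\subset\mathfrak h\wedge\mathfrak g$. -/

import Mathlib

open scoped Manifold ContDiff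

noncomputable section

namespace PoissonLie

/-! ### Bivectors: multilinear algebra -/

section Algebra

variable {V : Type*} [AddCommGroup V] [Module ℝ V]

/-- The decomposable bivector `u ∧ v` in `⋀² V`. -/
def wedge (u v : V) : ⋀[ℝ]^2 V := exteriorPower.ιMulti ℝ 2 ![u, v]

theorem wedge_swap (u v : V) : wedge u v = -wedge v u := by
  have h := (exteriorPower.ιMulti ℝ 2 (M := V)).map_swap ![v, u] (i := 0) (j := 1) (by decide)
  have e : ![v, u] ∘ Equiv.swap (0 : Fin 2) 1 = ![u, v] := by
    ext i
    fin_cases i <;> simp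
  rw [e] at h
  exact h

theorem wedge_add_left (a b c : V) : wedge (a + b) c = wedge a c + wedge b c :=
  (exteriorPower.ιMulti ℝ 2 (M := V)).toMultilinearMap.cons_add ![c] a b

theorem wedge_smul_left (r : ℝ) (a c : V) : wedge (r • a) c = r • wedge a c :=
  (exteriorPower.ιMulti ℝ 2 (M := V)).toMultilinearMap.cons_smul ![c] r a

theorem wedge_add_right (a b c : V) : wedge c (a + b) = wedge c a + wedge c b := by
  rw [wedge_swap, wedge_add_left, wedge_swap a, wedge_swap b, neg_add, neg_neg, neg_neg]

theorem wedge_smul_right (r : ℝ) (a c : V) : wedge c (r • a) = r • wedge c a := by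
  rw [wedge_swap, wedge_smul_left, wedge_swap a, smul_neg, neg_neg]

/-- The alternating map `(u, v) ↦ f u ∧ v + u ∧ f v`. -/
def derivationAlt (f : V →ₗ[ℝ] V) : V [⋀^Fin 2]→ₗ[ℝ] ⋀[ℝ]^2 V where
  toFun m := wedge (f (m 0)) (m 1) + wedge (m 0) (f (m 1))
  map_update_add' := by
    intro _ m i x y
    fin_cases i <;> simp [wedge_add_left, wedge_add_right] <;> abel
  map_update_smul' := by
    intro _ m i c x
    fin_cases i <;> simp [wedge_smul_left, wedge_smul_right]
  map_eq_zero_of_eq' := by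
    intro m i j hij hne
    have h01 : m 0 = m 1 := by
      fin_cases i <;> fin_cases j <;> simp_all
    rw [h01, wedge_swap (m 1) (f (m 1)), add_neg_cancel]

/-- The extension of an endomorphism `f` of `V` to `⋀² V` as a derivation:
`u ∧ v ↦ f u ∧ v + u ∧ f v`. -/
def derivationExt (f : V →ₗ[ℝ] V) : ⋀[ℝ]^2 V →ₗ[ℝ] ⋀[ℝ]^2 V :=
  exteriorPower.alternatingMapLinearEquiv (derivationAlt f)

theorem derivationExt_wedge (f : V →ₗ[ℝ] V) (u v : V) :
    derivationExt f (wedge u v) = wedge (f u) v + wedge u (f v) := by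
  simp [derivationExt, wedge, derivationAlt]

/-- For a subspace `W` of `V`, the subspace `W ∧ V` of `⋀² V` spanned by all `w ∧ v` with
`w ∈ W` and `v ∈ V`. -/
def wedgeTop (W : Submodule ℝ V) : Submodule ℝ (⋀[ℝ]^2 V) :=
  Submodule.span ℝ {b | ∃ w ∈ W, ∃ v : V, b = wedge w v}

end Algebra

/-! ### Lie groups -/

variable {E : Type*} [NormedAddCommGroup E] [NormedSpace ℝ E]
  {G : Type*} [TopologicalSpace G] [ChartedSpace E G]

/-- The space `⋀² T_g G` of bivectors at `g`. -/
abbrev BivectorAt (E : Type*) [NormedAddCommGroup E] [NormedSpace ℝ E]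
    {G : Type*} [TopologicalSpace G] [ChartedSpace E G] (g : G) : Type _ :=
  ⋀[ℝ]^2 (TangentSpace 𝓘(ℝ, E) g)

/-- The differential `df` of a real function at the point `g`, as a linear form on `T_g G`. -/
def differential (E : Type*) [NormedAddCommGroup E] [NormedSpace ℝ E]
    {G : Type*} [TopologicalSpace G] [ChartedSpace E G]
    (f : G → ℝ) (g : G) : Module.Dual ℝ (TangentSpace 𝓘(ℝ, E) g) :=
  (mfderiv 𝓘(ℝ, E) 𝓘(ℝ, ℝ) f g).toLinearMap

/-- The bracket `{f₁, f₂} = (df₁ ∧ df₂)(π)` of two functions defined by a field of bivectors. -/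
def bracket (π : ∀ g : G, BivectorAt E g) (f₁ f₂ : G → ℝ) : G → ℝ := fun g =>
  exteriorPower.pairingDual ℝ (TangentSpace 𝓘(ℝ, E) g) 2
    (wedge (differential E f₁ g) (differential E f₂ g)) (π g)

/-- `π` is a Poisson 2-tensor: it is smooth (equivalently, the bracket of smooth functions is
smooth) and its bracket satisfies the Jacobi identity. -/
structure IsPoisson (π : ∀ g : G, BivectorAt E g) : Prop where
  smooth : ∀ f₁ f₂ : G → ℝ, ContMDiff 𝓘(ℝ, E) 𝓘(ℝ, ℝ) ∞ f₁ →
    ContMDiff 𝓘(ℝ, E) 𝓘(ℝ, ℝ) ∞ f₂ → ContMDiff 𝓘(ℝ, E) 𝓘(ℝ, ℝ) ∞ (bracket π f₁ f₂)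
  jacobi : ∀ f₁ f₂ f₃ : G → ℝ, ContMDiff 𝓘(ℝ, E) 𝓘(ℝ, ℝ) ∞ f₁ →
    ContMDiff 𝓘(ℝ, E) 𝓘(ℝ, ℝ) ∞ f₂ → ContMDiff 𝓘(ℝ, E) 𝓘(ℝ, ℝ) ∞ f₃ → ∀ g : G,
      bracket π f₁ (bracket π f₂ f₃) g + bracket π f₂ (bracket π f₃ f₁) g
        + bracket π f₃ (bracket π f₁ f₂) g = 0

variable [Group G]

/-- The map `L_g : ⋀² T_x G → ⋀² T_y G`, for `y = g x`, induced by left translation by `g`. -/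
def leftTranslate (g : G) {x y : G} (h : g * x = y) : BivectorAt E x →ₗ[ℝ] BivectorAt E y :=
  h ▸ exteriorPower.map 2 (mfderiv 𝓘(ℝ, E) 𝓘(ℝ, E) (fun z : G => g * z) x).toLinearMap

/-- The map `R_g : ⋀² T_x G → ⋀² T_y G`, for `y = x g`, induced by right translation by `g`. -/
def rightTranslate (g : G) {x y : G} (h : x * g = y) : BivectorAt E x →ₗ[ℝ] BivectorAt E y :=
  h ▸ exteriorPower.map 2 (mfderiv 𝓘(ℝ, E) 𝓘(ℝ, E) (fun z : G => z * g) x).toLinearMap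

/-- `(G, π)` is a Poisson-Lie group: `π` is a Poisson 2-tensor which is multiplicative,
`π(gh) = L_g π(h) + R_h π(g)`. -/
structure IsPoissonLie (π : ∀ g : G, BivectorAt E g) : Prop where
  isPoisson : IsPoisson π
  multiplicative : ∀ g h : G,
    π (g * h) = leftTranslate g rfl (π h) + rightTranslate h rfl (π g)

/-- The right translate `π_σ(g) = R_σ(π(g σ⁻¹))` of a field of bivectors. -/
def translated (π : ∀ g : G, BivectorAt E g) (σ : G) : ∀ g : G, BivectorAt E g := fun g =>
  rightTranslate σ (inv_mul_cancel_right g σ) (π (g * σ⁻¹))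

/-- The element `X_σ = R_σ(π(σ⁻¹))` of `𝔤 ∧ 𝔤`. -/
def translationBivector (π : ∀ g : G, BivectorAt E g) (σ : G) : BivectorAt E (1 : G) :=
  rightTranslate σ (inv_mul_cancel σ) (π σ⁻¹)

/-- The operator `ad_x` on `𝔤 ∧ 𝔤`, `ad_x(u ∧ v) = [x, u] ∧ v + u ∧ [x, v]`. -/
def adBivector [FiniteDimensional ℝ E] [LieGroup 𝓘(ℝ, E) ∞ G]
    (x : GroupLieAlgebra 𝓘(ℝ, E) G) : BivectorAt E (1 : G) →ₗ[ℝ] BivectorAt E (1 : G) :=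
  haveI : CompleteSpace E := FiniteDimensional.complete ℝ E
  haveI : LieGroup 𝓘(ℝ, E) (minSmoothness ℝ 3) G :=
    LieGroup.of_le (n := ∞) (by
      rw [minSmoothness_of_isRCLikeNormedField]
      exact ENat.LEInfty.out)
  derivationExt (LieAlgebra.ad ℝ (GroupLieAlgebra 𝓘(ℝ, E) G) x)

theorem tangentBundle_mk_eq_iff {G : Type*} [TopologicalSpace G] [ChartedSpace E G]
    (p q : G) (v w : E) :
    (⟨p, v⟩ : TangentBundle 𝓘(ℝ, E) G) = ⟨q, w⟩ ↔ p = q ∧ v = w := by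
  constructor
  · intro h
    injection h with h1 h2
    exact ⟨h1, h2⟩
  · rintro ⟨rfl, rfl⟩
    rfl

theorem mfderiv_eq_id {G : Type*} [TopologicalSpace G] [ChartedSpace E G] {f : G → G} (hf : f = id) (p : G) :
    (mfderiv 𝓘(ℝ, E) 𝓘(ℝ, E) f p : E →L[ℝ] E) = ContinuousLinearMap.id ℝ E := by
  subst hf
  exact mfderiv_id

theorem tangentMap_curve_iff {γ : ℝ → G} (hγ : ContMDiff 𝓘(ℝ, ℝ) 𝓘(ℝ, E) ∞ γ) (x : E) :
    tangentMap 𝓘(ℝ, ℝ) 𝓘(ℝ, E) γ ⟨0, (1 : ℝ)⟩ = (⟨1, x⟩ : TangentBundle 𝓘(ℝ, E) G) ↔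
      γ 0 = 1 ∧ HasMFDerivAt 𝓘(ℝ, ℝ) 𝓘(ℝ, E) γ 0
        (ContinuousLinearMap.toSpanSingleton ℝ x : ℝ →L[ℝ] E) := by
  have hd : HasMFDerivAt 𝓘(ℝ, ℝ) 𝓘(ℝ, E) γ 0 (mfderiv 𝓘(ℝ, ℝ) 𝓘(ℝ, E) γ 0) :=
    ((hγ 0).mdifferentiableAt (by simp)).hasMFDerivAt
  generalize hD : mfderiv 𝓘(ℝ, ℝ) 𝓘(ℝ, E) γ 0 = D at hd
  change ℝ →L[ℝ] E at D
  have hD1 : D = ContinuousLinearMap.toSpanSingleton ℝ (D 1) := by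
    ext
    simp
  constructor
  · intro h
    replace h := (tangentBundle_mk_eq_iff _ _ _ _).1 h
    have h2 : mfderiv 𝓘(ℝ, ℝ) 𝓘(ℝ, E) γ 0 (1 : ℝ) = x := h.2
    rw [hD] at h2
    have h3 : D 1 = x := h2
    rw [h3] at hD1
    exact ⟨h.1, hD1 ▸ hd⟩
  · rintro ⟨h0, h⟩
    have h3 : D = ContinuousLinearMap.toSpanSingleton ℝ x := hasMFDerivAt_unique hd h
    have h4 : D 1 = x := by simp [h3]
    have h2 : mfderiv 𝓘(ℝ, ℝ) 𝓘(ℝ, E) γ 0 (1 : ℝ) = x := by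
      rw [hD]
      exact h4
    exact (tangentBundle_mk_eq_iff _ _ _ _).2 ⟨h0, h2⟩

theorem hasMFDerivAt_curve_mul [LieGroup 𝓘(ℝ, E) ∞ G] {γ δ : ℝ → G} (x y : E)
    (h0 : γ 0 = 1) (h0' : δ 0 = 1)
    (h : HasMFDerivAt 𝓘(ℝ, ℝ) 𝓘(ℝ, E) γ 0
      (ContinuousLinearMap.toSpanSingleton ℝ x : ℝ →L[ℝ] E))
    (h' : HasMFDerivAt 𝓘(ℝ, ℝ) 𝓘(ℝ, E) δ 0
      (ContinuousLinearMap.toSpanSingleton ℝ y : ℝ →L[ℝ] E)) :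
    HasMFDerivAt 𝓘(ℝ, ℝ) 𝓘(ℝ, E) (fun t => γ t * δ t) 0
      (ContinuousLinearMap.toSpanSingleton ℝ (x + y) : ℝ →L[ℝ] E) := by
  have hm : MDifferentiableAt (𝓘(ℝ, E).prod 𝓘(ℝ, E)) 𝓘(ℝ, E) (fun p : G × G => p.1 * p.2)
      (γ 0, δ 0) := ((contMDiff_mul 𝓘(ℝ, E) ∞) _).mdifferentiableAt (by simp)
  have hc := hm.hasMFDerivAt.comp (0 : ℝ) (h.prodMk h')
  have key : ∀ v w : E, (mfderiv (𝓘(ℝ, E).prod 𝓘(ℝ, E)) 𝓘(ℝ, E) (fun p : G × G => p.1 * p.2)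
      (γ 0, δ 0) : E × E →L[ℝ] E) (v, w) = v + w := by
    intro v w
    rw [h0, h0'] at hm ⊢
    refine (mfderiv_prod_eq_add_apply (v := ((v, w) : E × E)) hm).trans ?_
    have e1 := mfderiv_eq_id (E := E) (f := fun z : G => z * 1) (funext mul_one) 1
    have e2 := mfderiv_eq_id (E := E) (f := fun z : G => 1 * z) (funext one_mul) 1
    exact congrArg₂ (fun a b : E => a + b)
      (DFunLike.congr_fun (F := E →L[ℝ] E) e1 v) (DFunLike.congr_fun (F := E →L[ℝ] E) e2 w)
  generalize mfderiv (𝓘(ℝ, E).prod 𝓘(ℝ, E)) 𝓘(ℝ, E) (fun p : G × G => p.1 * p.2)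
      (γ 0, δ 0) = D at hc key
  change E × E →L[ℝ] E at D
  have e : ContinuousLinearMap.toSpanSingleton ℝ (x + y) = D.comp
      ((ContinuousLinearMap.toSpanSingleton ℝ x).prod
        (ContinuousLinearMap.toSpanSingleton ℝ y)) := by
    ext
    refine Eq.trans ?_ (Eq.trans (key x y).symm ?_)
    · simp
    · simp only [ContinuousLinearMap.comp_apply, ContinuousLinearMap.prod_apply,
        ContinuousLinearMap.toSpanSingleton_apply, one_smul]
      rfl
  rw [e]
  exact hc

theorem hasMFDerivAt_curve_smul {G : Type*} [TopologicalSpace G] [ChartedSpace E G]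
    {γ : ℝ → G} (c : ℝ) (x : E)
    (h : HasMFDerivAt 𝓘(ℝ, ℝ) 𝓘(ℝ, E) γ 0
      (ContinuousLinearMap.toSpanSingleton ℝ x : ℝ →L[ℝ] E)) :
    HasMFDerivAt 𝓘(ℝ, ℝ) 𝓘(ℝ, E) (fun t => γ (c * t)) 0
      (ContinuousLinearMap.toSpanSingleton ℝ (c • x) : ℝ →L[ℝ] E) := by
  have hl : HasMFDerivAt 𝓘(ℝ, ℝ) 𝓘(ℝ, ℝ) (fun t : ℝ => c * t) 0
      (c • ContinuousLinearMap.id ℝ ℝ) :=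
    ((hasFDerivAt_id (𝕜 := ℝ) (0 : ℝ)).const_mul c).hasMFDerivAt
  have h' : HasMFDerivAt 𝓘(ℝ, ℝ) 𝓘(ℝ, E) γ (c * 0)
      (ContinuousLinearMap.toSpanSingleton ℝ x : ℝ →L[ℝ] E) := by
    rw [mul_zero]
    exact h
  have e : ContinuousLinearMap.toSpanSingleton ℝ (c • x) =
      (ContinuousLinearMap.toSpanSingleton ℝ x).comp (c • ContinuousLinearMap.id ℝ ℝ) := by
    ext
    simp
  rw [e]
  exact HasMFDerivAt.comp (0 : ℝ) h' hl

/-- The Lie algebra `𝔥 ⊆ 𝔤 = T_1 G` of a subgroup `H` of `G`: the vectors `γ'(0)`, where `γ` runs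
through the smooth curves in `G` with values in `H` and `γ(0) = 1`. -/
def subgroupLieAlgebra [LieGroup 𝓘(ℝ, E) ∞ G] (H : Subgroup G) :
    Submodule ℝ (GroupLieAlgebra 𝓘(ℝ, E) G) where
  carrier := {x | ∃ γ : ℝ → G, ContMDiff 𝓘(ℝ, ℝ) 𝓘(ℝ, E) ∞ γ ∧ (∀ t, γ t ∈ H) ∧
    tangentMap 𝓘(ℝ, ℝ) 𝓘(ℝ, E) γ ⟨0, (1 : ℝ)⟩ = (⟨1, x⟩ : TangentBundle 𝓘(ℝ, E) G)}
  zero_mem' := by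
    refine ⟨fun _ => 1, contMDiff_const, fun _ => H.one_mem, ?_⟩
    rw [tangentMap, mfderiv_const]
    rfl
  add_mem' := by
    rintro x y ⟨γ, hγ, hγH, hx⟩ ⟨δ, hδ, hδH, hy⟩
    refine ⟨fun t => γ t * δ t, hγ.mul hδ, fun t => H.mul_mem (hγH t) (hδH t), ?_⟩
    obtain ⟨h0, h⟩ := (tangentMap_curve_iff hγ (x : E)).1 hx
    obtain ⟨h0', h'⟩ := (tangentMap_curve_iff hδ (y : E)).1 hy
    exact (tangentMap_curve_iff (E := E) (hγ.mul hδ) _).2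
      ⟨by simp [h0, h0'], hasMFDerivAt_curve_mul (E := E) x y h0 h0' h h'⟩
  smul_mem' := by
    rintro c x ⟨γ, hγ, hγH, hx⟩
    have hs : ContMDiff 𝓘(ℝ, ℝ) 𝓘(ℝ, E) ∞ (fun t : ℝ => γ (c * t)) :=
      hγ.comp (contDiff_const.mul contDiff_id).contMDiff
    refine ⟨fun t => γ (c * t), hs, fun t => hγH _, ?_⟩
    obtain ⟨h0, h⟩ := (tangentMap_curve_iff hγ (x : E)).1 hx
    exact (tangentMap_curve_iff (E := E) hs _).2 ⟨by simp [h0], hasMFDerivAt_curve_smul (E := E) c x h⟩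

/-- The subgroup `H` is coisotropic with respect to the field of bivectors `ρ`:
`ρ(gh) - R_h ρ(g) ∈ L_{gh}(𝔥 ∧ 𝔤)` for all `g ∈ G` and `h ∈ H`. -/
def IsCoisotropic [LieGroup 𝓘(ℝ, E) ∞ G] (ρ : ∀ g : G, BivectorAt E g) (H : Subgroup G) : Prop :=
  ∀ g : G, ∀ h ∈ H, ρ (g * h) - rightTranslate h rfl (ρ g) ∈
    (wedgeTop (subgroupLieAlgebra (E := E) H)).map (leftTranslate (g * h) (mul_one (g * h)))

end PoissonLie

end

/-! Multiplicativity gives `π_σ(g) = π(g) + L_g X_σ`. Since `R_h L_g = L_{gh} Ad_{h⁻¹}`, the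
coisotropy defect of `π_σ` at `(g, h)` is that of `π` plus `L_{gh}(X_σ - Ad_{h⁻¹} X_σ)`. As `H` is
coisotropic for `π`, coisotropy for `π_σ` says exactly that every `h ∈ H` fixes `X_σ` modulo `𝔥 ∧
𝔤`: `H` lies in its subgroup `classStabilizer H X_σ` (`isCoisotropic_translated_iff_le`).

Differentiating this along curves in `H` gives the infinitesimal condition
(`derivationExt_mem_of_le`), once the bracket of left invariant fields is known to be the derivative
of `Ad` (`tangentCoord_bracket`). Conversely, the infinitesimal condition makes the class of
`Ad_{γ(t)} X_σ` constant along every smooth curve `γ` in `H` from the identity, so the closed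
subgroup `S = classStabilizer H X_σ` contains all these curves (`curve_mem_classStabilizer`).

It remains to see that such an `S` contains a neighbourhood of the identity in `H`; connectedness
then gives `H ≤ S`. This is a form of the closed subgroup theorem, proved without the exponential
map. Limit directions of `H` at the identity are velocities of smooth curves in `H`, because
integral curves of the corresponding left invariant fields cannot leave the closed set `H`
(`IsTangent.mem_lieSubspace`). If elements of `H` outside `S` accumulated at the identity, one could
choose them almost closest to it in their `S`-cosets, take a limit direction `w`, and multiply by a
curve in `S` with velocity `-w`; this would bring them much closer, a contradiction
(`eventually_mem_of_curves_mem`). -/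

noncomputable section

namespace PoissonLie

/-! ### Translations in coordinates; coisotropy of `π_σ` as a condition on `Ad` -/

section

variable {E : Type*} [NormedAddCommGroup E] [NormedSpace ℝ E]
  {G : Type*} [TopologicalSpace G] [ChartedSpace E G] [Group G]

/-- The differential at `x` of the left translation by `g`, all tangent spaces being identified
with the model space `E` by means of the preferred charts. -/
def dLeft (E : Type*) [NormedAddCommGroup E] [NormedSpace ℝ E]
    {G : Type*} [TopologicalSpace G] [ChartedSpace E G] [Group G] (g x : G) : E →L[ℝ] E :=
  mfderiv 𝓘(ℝ, E) 𝓘(ℝ, E) (fun z : G => g * z) x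

/-- The differential at `x` of the right translation by `g`, all tangent spaces being identified
with the model space `E` by means of the preferred charts. -/
def dRight (E : Type*) [NormedAddCommGroup E] [NormedSpace ℝ E]
    {G : Type*} [TopologicalSpace G] [ChartedSpace E G] [Group G] (g x : G) : E →L[ℝ] E :=
  mfderiv 𝓘(ℝ, E) 𝓘(ℝ, E) (fun z : G => z * g) x

/-! ### Functoriality of the exterior square -/

section Bivectors

variable {V V' V'' : Type*} [AddCommGroup V] [Module ℝ V] [AddCommGroup V'] [Module ℝ V']
  [AddCommGroup V''] [Module ℝ V'']

/-- The linear map `⋀² V → ⋀² V'` induced by a linear map `V → V'`. -/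
def bimap (f : V →ₗ[ℝ] V') : ⋀[ℝ]^2 V →ₗ[ℝ] ⋀[ℝ]^2 V' := exteriorPower.map 2 f

theorem bimap_bimap (g : V' →ₗ[ℝ] V'') (f : V →ₗ[ℝ] V') (b : ⋀[ℝ]^2 V) :
    bimap g (bimap f b) = bimap (g ∘ₗ f) b :=
  (DFunLike.congr_fun (exteriorPower.map_comp (n := 2) f g) b).symm

theorem bimap_id (b : ⋀[ℝ]^2 V) : bimap LinearMap.id b = b :=
  DFunLike.congr_fun (exteriorPower.map_id (R := ℝ) (M := V) (n := 2)) b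

theorem bimap_wedge (f : V →ₗ[ℝ] V') (u v : V) : bimap f (wedge u v) = wedge (f u) (f v) := by
  unfold bimap wedge
  rw [exteriorPower.map_apply_ιMulti]
  congr 1
  ext i
  fin_cases i <;> rfl

theorem bivector_induction {p : ⋀[ℝ]^2 V → Prop} (b : ⋀[ℝ]^2 V)
    (zero : p 0) (add : ∀ x y, p x → p y → p (x + y)) (smul : ∀ (c : ℝ) x, p x → p (c • x))
    (wedge : ∀ u v, p (wedge u v)) : p b := by
  have hb : b ∈ Submodule.span ℝ (Set.range (exteriorPower.ιMulti ℝ 2 (M := V))) := by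
    rw [exteriorPower.ιMulti_span]
    trivial
  induction hb using Submodule.span_induction with
  | mem x hx =>
    obtain ⟨m, rfl⟩ := hx
    have : m = ![m 0, m 1] := by
      ext i
      fin_cases i <;> rfl
    rw [this]
    exact wedge _ _
  | zero => exact zero
  | add x y _ _ hx hy => exact add x y hx hy
  | smul c x _ hx => exact smul c x hx

theorem bimap_mem_wedgeTop {f : V →ₗ[ℝ] V'} {W : Submodule ℝ V} {W' : Submodule ℝ V'}
    (h : ∀ w ∈ W, f w ∈ W') {b : ⋀[ℝ]^2 V} (hb : b ∈ wedgeTop W) : bimap f b ∈ wedgeTop W' := by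
  induction hb using Submodule.span_induction with
  | mem x hx =>
    obtain ⟨w, hw, v, rfl⟩ := hx
    rw [bimap_wedge]
    exact Submodule.subset_span ⟨_, h w hw, _, rfl⟩
  | zero => simp
  | add x y _ _ hx hy => simpa using add_mem hx hy
  | smul c x _ hx => simpa using Submodule.smul_mem _ c hx

theorem bimap_derivationExt {e : V →ₗ[ℝ] V'} {f : V →ₗ[ℝ] V} {f' : V' →ₗ[ℝ] V'}
    (h : ∀ v, e (f v) = f' (e v)) (b : ⋀[ℝ]^2 V) :
    bimap e (derivationExt f b) = derivationExt f' (bimap e b) := by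
  induction b using bivector_induction with
  | zero => simp
  | add x y hx hy => simp [hx, hy]
  | smul c x hx => simp [hx]
  | wedge u v => simp [bimap_wedge, derivationExt_wedge, h]

/-- The linear equivalence `⋀² V ≃ ⋀² V'` induced by a linear equivalence `V ≃ V'`. -/
def biequiv (e : V ≃ₗ[ℝ] V') : ⋀[ℝ]^2 V ≃ₗ[ℝ] ⋀[ℝ]^2 V' :=
  LinearEquiv.ofLinearMap (bimap e) (bimap e.symm)
    (LinearMap.ext fun b => by simp [bimap_bimap, bimap_id])
    (LinearMap.ext fun b => by simp [bimap_bimap, bimap_id])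

theorem biequiv_apply (e : V ≃ₗ[ℝ] V') (b : ⋀[ℝ]^2 V) : biequiv e b = bimap e b := rfl

theorem biequiv_mem_wedgeTop_iff (e : V ≃ₗ[ℝ] V') (W : Submodule ℝ V) (b : ⋀[ℝ]^2 V) :
    biequiv e b ∈ wedgeTop (W.map (e : V →ₗ[ℝ] V')) ↔ b ∈ wedgeTop W := by
  constructor
  · intro h
    have h2 : biequiv e.symm (biequiv e b) ∈ wedgeTop W := by
      refine bimap_mem_wedgeTop ?_ h
      rintro _ ⟨w, hw, rfl⟩
      simpa using hw
    rw [biequiv_apply, biequiv_apply, bimap_bimap] at h2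
    simpa [bimap_id] using h2
  · exact bimap_mem_wedgeTop fun w hw => Submodule.mem_map_of_mem hw

end Bivectors

/-- The identification of the tangent space at `g` with the model space by means of the preferred
chart at `g`. -/
def tangentCoord (E : Type*) [NormedAddCommGroup E] [NormedSpace ℝ E]
    {G : Type*} [TopologicalSpace G] [ChartedSpace E G] (g : G) :
    TangentSpace 𝓘(ℝ, E) g ≃ₗ[ℝ] E where
  toFun v := v
  invFun v := v
  map_add' _ _ := rfl
  map_smul' _ _ := rfl
  left_inv _ := rfl
  right_inv _ := rfl

/-- The identification of the bivectors at `g` with the bivectors of the model space. -/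
def coord (g : G) : BivectorAt E g ≃ₗ[ℝ] ⋀[ℝ]^2 E := biequiv (tangentCoord E g)

/-- Every tangent space is definitionally `E`, so the transport along `h` disappears after
substitution. Identities between bivectors at points that are only provably equal become identities
in the single space `⋀² E`. -/
theorem coord_leftTranslate (g : G) {x y : G} (h : g * x = y) (b : BivectorAt E x) :
    coord y (leftTranslate (E := E) g h b) = bimap (dLeft E g x).toLinearMap (coord x b) := by
  subst h
  refine (bimap_bimap _ _ b).trans (Eq.trans ?_ (bimap_bimap _ _ b).symm)
  rfl

theorem coord_rightTranslate (g : G) {x y : G} (h : x * g = y) (b : BivectorAt E x) :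
    coord y (rightTranslate (E := E) g h b) = bimap (dRight E g x).toLinearMap (coord x b) := by
  subst h
  refine (bimap_bimap _ _ b).trans (Eq.trans ?_ (bimap_bimap _ _ b).symm)
  rfl

theorem bimap_coe_id (b : ⋀[ℝ]^2 E) :
    bimap (ContinuousLinearMap.id ℝ E).toLinearMap b = b := bimap_id b

theorem dLeft_one (x : G) : dLeft E (1 : G) x = ContinuousLinearMap.id ℝ E :=
  mfderiv_eq_id (E := E) (funext one_mul) x

theorem dRight_one (x : G) : dRight E (1 : G) x = ContinuousLinearMap.id ℝ E :=
  mfderiv_eq_id (E := E) (funext mul_one) x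

section LieGroup

variable [LieGroup 𝓘(ℝ, E) ∞ G]

theorem mdifferentiableAt_mul_left (g x : G) :
    MDifferentiableAt 𝓘(ℝ, E) 𝓘(ℝ, E) (fun z : G => g * z) x :=
  (contMDiff_mul_left (I := 𝓘(ℝ, E)) (n := ∞) (a := g) x).mdifferentiableAt (by simp)

theorem mdifferentiableAt_mul_right (g x : G) :
    MDifferentiableAt 𝓘(ℝ, E) 𝓘(ℝ, E) (fun z : G => z * g) x :=
  (contMDiff_mul_right (I := 𝓘(ℝ, E)) (n := ∞) (a := g) x).mdifferentiableAt (by simp)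

theorem dLeft_comp_dLeft (g h x : G) :
    (dLeft E g (h * x)).comp (dLeft E h x) = dLeft E (g * h) x := by
  have := mfderiv_comp x (mdifferentiableAt_mul_left (E := E) g (h * x))
    (mdifferentiableAt_mul_left (E := E) h x)
  refine Eq.trans this.symm ?_
  unfold dLeft
  congr 1
  ext z
  simp [mul_assoc]

theorem dRight_comp_dRight (g h x : G) :
    (dRight E g (x * h)).comp (dRight E h x) = dRight E (h * g) x := by
  have := mfderiv_comp x (mdifferentiableAt_mul_right (E := E) g (x * h))
    (mdifferentiableAt_mul_right (E := E) h x)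
  refine Eq.trans this.symm ?_
  unfold dRight
  congr 1
  ext z
  simp [mul_assoc]

theorem dLeft_comp_dRight (g h x : G) :
    (dLeft E g (x * h)).comp (dRight E h x) = (dRight E h (g * x)).comp (dLeft E g x) := by
  have h1 := mfderiv_comp x (mdifferentiableAt_mul_left (E := E) g (x * h))
    (mdifferentiableAt_mul_right (E := E) h x)
  have h2 := mfderiv_comp x (mdifferentiableAt_mul_right (E := E) h (g * x))
    (mdifferentiableAt_mul_left (E := E) g x)
  refine Eq.trans h1.symm (Eq.trans ?_ h2)
  congr 1
  ext z
  simp [mul_assoc]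

/-- The adjoint action of `g` on the Lie algebra. -/
def Ad (E : Type*) [NormedAddCommGroup E] [NormedSpace ℝ E]
    {G : Type*} [TopologicalSpace G] [ChartedSpace E G] [Group G] (g : G) : E →L[ℝ] E :=
  (dLeft E g g⁻¹).comp (dRight E g⁻¹ 1)

/-- The Lie algebra of a subgroup, as a subspace of the model space. -/
def lieSubspace (E : Type*) [NormedAddCommGroup E] [NormedSpace ℝ E]
    {G : Type*} [TopologicalSpace G] [ChartedSpace E G] [Group G] [LieGroup 𝓘(ℝ, E) ∞ G]
    (H : Subgroup G) : Submodule ℝ E :=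
  (subgroupLieAlgebra (E := E) H).map (tangentCoord E (1 : G) : _ →ₗ[ℝ] E)

/-- Apply `R_σ` to `π(gσ⁻¹) = L_g π(σ⁻¹) + R_{σ⁻¹} π(g)`: it commutes with `L_g` and cancels
`R_{σ⁻¹}`. -/
theorem coord_translated {π : ∀ g : G, BivectorAt E g} (hπ : IsPoissonLie π) (σ g : G) :
    coord g (translated π σ g) = coord g (π g) +
      bimap (dLeft E g 1).toLinearMap (coord 1 (translationBivector π σ)) := by
  unfold translated translationBivector
  rw [hπ.multiplicative g σ⁻¹]
  simp only [coord_leftTranslate, coord_rightTranslate, map_add, bimap_bimap,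
    ← ContinuousLinearMap.toLinearMap_comp]
  rw [dRight_comp_dRight, ← dLeft_comp_dRight, inv_mul_cancel, dRight_one, bimap_coe_id, add_comm]

theorem bimap_dLeft_injective (g : G) : Function.Injective (bimap (dLeft E g 1).toLinearMap) := by
  apply Function.LeftInverse.injective (g := bimap (dLeft E g⁻¹ (g * 1)).toLinearMap)
  intro b
  rw [bimap_bimap, ← ContinuousLinearMap.toLinearMap_comp, dLeft_comp_dLeft, inv_mul_cancel,
    dLeft_one, bimap_coe_id]

/-- `R_h L_g = L_g R_h = L_{gh} (L_{h⁻¹} R_h)`, and the last factor is `Ad_{h⁻¹}`. -/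
theorem dRight_comp_dLeft_one (g h : G) :
    (dRight E h g).comp (dLeft E g 1) = (dLeft E (g * h) 1).comp (Ad E h⁻¹) := by
  have := dLeft_comp_dLeft (E := E) (g * h) h⁻¹ h
  rw [inv_mul_cancel, mul_inv_cancel_right] at this
  rw [Ad, inv_inv, ← ContinuousLinearMap.comp_assoc, this]
  simpa using (dLeft_comp_dRight (E := E) g h 1).symm

theorem mem_wedgeTop_iff_coord (H : Subgroup G) (b : BivectorAt E (1 : G)) :
    b ∈ wedgeTop (subgroupLieAlgebra (E := E) H) ↔ coord 1 b ∈ wedgeTop (lieSubspace E H) :=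
  (biequiv_mem_wedgeTop_iff _ _ b).symm

theorem mem_map_leftTranslate_iff (H : Subgroup G) (g : G) (b : BivectorAt E g) :
    b ∈ (wedgeTop (subgroupLieAlgebra (E := E) H)).map (leftTranslate g (mul_one g)) ↔
      coord g b ∈ (wedgeTop (lieSubspace E H)).map (bimap (dLeft E g 1).toLinearMap) := by
  constructor
  · rintro ⟨c, hc, rfl⟩
    exact ⟨_, (mem_wedgeTop_iff_coord H c).1 hc, (coord_leftTranslate g (mul_one g) c).symm⟩
  · rintro ⟨c, hc, hcb⟩
    refine ⟨(coord 1).symm c, (mem_wedgeTop_iff_coord H _).2 (by simpa using hc), ?_⟩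
    apply (coord g).injective
    rw [coord_leftTranslate, LinearEquiv.apply_symm_apply, hcb]

/-- The defect of `π` already lies in `L_{gh}(𝔥 ∧ 𝔤)` and `L_{gh}` is injective, so only `X_σ -
Ad_{h⁻¹} X_σ` matters. This term does not involve `g`, hence testing at `g = 1` suffices. -/
theorem isCoisotropic_translated_iff {π : ∀ g : G, BivectorAt E g} (hπ : IsPoissonLie π)
    {H : Subgroup G} (hH : IsCoisotropic π H) (σ : G) :
    IsCoisotropic (translated π σ) H ↔ ∀ h ∈ H,
      coord 1 (translationBivector π σ) -
        bimap (Ad E h⁻¹).toLinearMap (coord 1 (translationBivector π σ)) ∈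
        wedgeTop (lieSubspace E H) := by
  have key : ∀ g : G, ∀ h ∈ H, ((translated π σ (g * h) -
      rightTranslate h rfl (translated π σ g) ∈
        (wedgeTop (subgroupLieAlgebra (E := E) H)).map (leftTranslate (g * h) (mul_one (g * h))))
      ↔ coord 1 (translationBivector π σ) -
        bimap (Ad E h⁻¹).toLinearMap (coord 1 (translationBivector π σ)) ∈
        wedgeTop (lieSubspace E H)) := by
    intro g h hh
    have h1 := (mem_map_leftTranslate_iff H _ _).1 (hH g h hh)
    rw [mem_map_leftTranslate_iff]
    have e : coord (g * h) (translated π σ (g * h) - rightTranslate h rfl (translated π σ g)) =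
        coord (g * h) (π (g * h) - rightTranslate h rfl (π g)) +
          bimap (dLeft E (g * h) 1).toLinearMap (coord 1 (translationBivector π σ) -
            bimap (Ad E h⁻¹).toLinearMap (coord 1 (translationBivector π σ))) := by
      simp only [map_sub, coord_rightTranslate, coord_translated hπ, map_add, bimap_bimap,
        ← ContinuousLinearMap.toLinearMap_comp]
      rw [dRight_comp_dLeft_one]
      abel
    rw [e, Submodule.add_mem_iff_right _ h1]
    constructor
    · rintro ⟨b, hb, hb'⟩
      rwa [← bimap_dLeft_injective _ hb']
    · exact fun hb => ⟨_, hb, rfl⟩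
  exact ⟨fun hc h hh => (key 1 h hh).1 (hc 1 h hh), fun hc g h hh => (key g h hh).2 (hc h hh)⟩

end LieGroup

end

/-! ### The group law in the chart at the identity; the derivative of `Ad` -/

section

open Filter Topology

variable {E : Type*} [NormedAddCommGroup E]
  {G : Type*} [TopologicalSpace G] [ChartedSpace E G] [Group G]

/-- The preferred chart at the identity. -/
abbrev idChart (E : Type*) [NormedAddCommGroup E] (G : Type*) [TopologicalSpace G]
    [ChartedSpace E G] [Group G] : OpenPartialHomeomorph G E := chartAt E (1 : G)

/-- The coordinate of the identity. -/
abbrev idCoord (E : Type*) [NormedAddCommGroup E] (G : Type*) [TopologicalSpace G]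
    [ChartedSpace E G] [Group G] : E := idChart E G 1

theorem one_mem_source : (1 : G) ∈ (idChart E G).source := mem_chart_source E 1

theorem idCoord_mem_target : idCoord E G ∈ (idChart E G).target := mem_chart_target E 1

theorem symm_idCoord : (idChart E G).symm (idCoord E G) = 1 :=
  (idChart E G).left_inv one_mem_source

theorem target_mem_nhds : (idChart E G).target ∈ 𝓝 (idCoord E G) :=
  (idChart E G).open_target.mem_nhds idCoord_mem_target

/-- The multiplication of `G` in the chart at the identity. -/
def chartMul (G : Type*) [TopologicalSpace G] [ChartedSpace E G] [Group G] (x y : E) : E :=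
  idChart E G ((idChart E G).symm x * (idChart E G).symm y)

/-- The conjugation of `G` in the chart at the identity. -/
def chartConj (G : Type*) [TopologicalSpace G] [ChartedSpace E G] [Group G] (x y : E) : E :=
  idChart E G ((idChart E G).symm x * (idChart E G).symm y * ((idChart E G).symm x)⁻¹)

theorem chartMul_idCoord {x : E} (hx : x ∈ (idChart E G).target) :
    chartMul G x (idCoord E G) = x := by
  rw [chartMul, symm_idCoord, mul_one, (idChart E G).right_inv hx]

theorem idCoord_chartMul {x : E} (hx : x ∈ (idChart E G).target) :
    chartMul G (idCoord E G) x = x := by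
  rw [chartMul, symm_idCoord, one_mul, (idChart E G).right_inv hx]

theorem chartConj_idCoord (x : E) : chartConj G x (idCoord E G) = idCoord E G := by
  rw [chartConj, symm_idCoord, mul_one, mul_inv_cancel]

theorem idCoord_chartConj {x : E} (hx : x ∈ (idChart E G).target) :
    chartConj G (idCoord E G) x = x := by
  rw [chartConj, symm_idCoord, one_mul, inv_one, mul_one, (idChart E G).right_inv hx]

variable [NormedSpace ℝ E]

/-- The differential at the identity of the left translation by the point with coordinate `x`. -/
def chartLeft (G : Type*) [TopologicalSpace G] [ChartedSpace E G] [Group G] (x : E) : E →L[ℝ] E :=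
  fderiv ℝ (chartMul G x) (idCoord E G)

/-- The differential at the identity of the right translation by the point with coordinate `x`. -/
def chartRight (G : Type*) [TopologicalSpace G] [ChartedSpace E G] [Group G] (x : E) :
    E →L[ℝ] E :=
  fderiv ℝ (fun y => chartMul G y x) (idCoord E G)

/-- The adjoint action of the point with coordinate `x`. -/
def chartAd (G : Type*) [TopologicalSpace G] [ChartedSpace E G] [Group G] (x : E) : E →L[ℝ] E :=
  fderiv ℝ (chartConj G x) (idCoord E G)

theorem chartLeft_idCoord : chartLeft G (idCoord E G) = ContinuousLinearMap.id ℝ E := by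
  have : chartMul G (idCoord E G) =ᶠ[𝓝 (idCoord E G)] id :=
    Filter.mem_of_superset target_mem_nhds fun _ hx => idCoord_chartMul hx
  rw [chartLeft, this.fderiv_eq, fderiv_id]

theorem chartRight_idCoord : chartRight G (idCoord E G) = ContinuousLinearMap.id ℝ E := by
  have : (fun x => chartMul G x (idCoord E G)) =ᶠ[𝓝 (idCoord E G)] id :=
    Filter.mem_of_superset target_mem_nhds fun _ hx => chartMul_idCoord hx
  rw [chartRight, this.fderiv_eq, fderiv_id]

theorem chartAd_idCoord : chartAd G (idCoord E G) = ContinuousLinearMap.id ℝ E := by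
  have : chartConj G (idCoord E G) =ᶠ[𝓝 (idCoord E G)] id :=
    Filter.mem_of_superset target_mem_nhds fun _ hx => idCoord_chartConj hx
  rw [chartAd, this.fderiv_eq, fderiv_id]

theorem mfderiv_eq_fderiv_idChart {f : G → G} (hf : MDifferentiableAt 𝓘(ℝ, E) 𝓘(ℝ, E) f 1)
    (h1 : f 1 = 1) : (mfderiv 𝓘(ℝ, E) 𝓘(ℝ, E) f 1 : E →L[ℝ] E) =
      fderiv ℝ (fun y => idChart E G (f ((idChart E G).symm y))) (idCoord E G) := by
  have h := hf.mfderiv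
  refine Eq.trans h ?_
  simp [writtenInExtChartAt, h1, Function.comp_def]
  rfl

variable [LieGroup 𝓘(ℝ, E) ∞ G]

theorem contMDiffAt_idChart {g : G} (hg : g ∈ (idChart E G).source) :
    ContMDiffAt 𝓘(ℝ, E) 𝓘(ℝ, E) ∞ (idChart E G) g :=
  contMDiffAt_of_mem_maximalAtlas (IsManifold.chart_mem_maximalAtlas 1) hg

theorem contMDiffAt_idChart_symm {x : E} (hx : x ∈ (idChart E G).target) :
    ContMDiffAt 𝓘(ℝ, E) 𝓘(ℝ, E) ∞ (idChart E G).symm x :=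
  contMDiffAt_symm_of_mem_maximalAtlas (IsManifold.chart_mem_maximalAtlas 1) hx

theorem contDiffAt_idChart_comp {F : Type*} [NormedAddCommGroup F] [NormedSpace ℝ F] {f : F → G}
    {p : F} (hf : ContMDiffAt 𝓘(ℝ, F) 𝓘(ℝ, E) ∞ f p) (hp : f p ∈ (idChart E G).source) :
    ContDiffAt ℝ ∞ (fun q => idChart E G (f q)) p :=
  ((contMDiffAt_idChart hp).comp p hf).contDiffAt

theorem contMDiffAt_symm_comp_fst {p : E × E} (hp : p.1 ∈ (idChart E G).target) :
    ContMDiffAt 𝓘(ℝ, E × E) 𝓘(ℝ, E) ∞ (fun q : E × E => (idChart E G).symm q.1) p :=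
  (contMDiffAt_idChart_symm hp).comp p contDiffAt_fst.contMDiffAt

theorem contMDiffAt_symm_comp_snd {p : E × E} (hp : p.2 ∈ (idChart E G).target) :
    ContMDiffAt 𝓘(ℝ, E × E) 𝓘(ℝ, E) ∞ (fun q : E × E => (idChart E G).symm q.2) p :=
  (contMDiffAt_idChart_symm hp).comp p contDiffAt_snd.contMDiffAt

/-- Joint smoothness is what makes the partial differentials `chartLeft` and `chartRight` depend
smoothly on the base point. -/
theorem contDiffAt_chartMul {x y : E} (hx : x ∈ (idChart E G).target)
    (hy : y ∈ (idChart E G).target)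
    (h : (idChart E G).symm x * (idChart E G).symm y ∈ (idChart E G).source) :
    ContDiffAt ℝ ∞ (Function.uncurry (chartMul (E := E) G)) (x, y) :=
  contDiffAt_idChart_comp ((contMDiffAt_symm_comp_fst (p := (x, y)) hx).mul
    (contMDiffAt_symm_comp_snd (p := (x, y)) hy)) h

theorem contDiffAt_chartConj {x y : E} (hx : x ∈ (idChart E G).target)
    (hy : y ∈ (idChart E G).target)
    (h : (idChart E G).symm x * (idChart E G).symm y * ((idChart E G).symm x)⁻¹ ∈
      (idChart E G).source) :
    ContDiffAt ℝ ∞ (Function.uncurry (chartConj (E := E) G)) (x, y) :=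
  contDiffAt_idChart_comp (((contMDiffAt_symm_comp_fst (p := (x, y)) hx).mul
    (contMDiffAt_symm_comp_snd (p := (x, y)) hy)).mul
      (contMDiffAt_symm_comp_fst (p := (x, y)) hx).inv) h

theorem contDiffAt_chartMul_right {x : E} (hx : x ∈ (idChart E G).target) :
    ContDiffAt ℝ ∞ (Function.uncurry (chartMul (E := E) G)) (x, idCoord E G) :=
  contDiffAt_chartMul hx idCoord_mem_target (by
    rw [symm_idCoord, mul_one]
    exact (idChart E G).map_target hx)

theorem contDiffAt_chartMul_left {x : E} (hx : x ∈ (idChart E G).target) :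
    ContDiffAt ℝ ∞ (Function.uncurry (chartMul (E := E) G)) (idCoord E G, x) :=
  contDiffAt_chartMul idCoord_mem_target hx (by
    rw [symm_idCoord, one_mul]
    exact (idChart E G).map_target hx)

theorem contDiffAt_chartConj_right {x : E} (hx : x ∈ (idChart E G).target) :
    ContDiffAt ℝ ∞ (Function.uncurry (chartConj (E := E) G)) (x, idCoord E G) :=
  contDiffAt_chartConj hx idCoord_mem_target (by
    rw [symm_idCoord, mul_one, mul_inv_cancel]
    exact one_mem_source)

theorem hasFDerivAt_chartMul_right {x : E} (hx : x ∈ (idChart E G).target) :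
    HasFDerivAt (chartMul G x) (chartLeft G x) (idCoord E G) := by
  have h := (contDiffAt_chartMul_right hx).differentiableAt (by simp)
  exact (DifferentiableAt.comp (f := fun y => (x, y)) (idCoord E G) h (by fun_prop)).hasFDerivAt

theorem hasFDerivAt_chartMul_left {x : E} (hx : x ∈ (idChart E G).target) :
    HasFDerivAt (fun y => chartMul G y x) (chartRight G x) (idCoord E G) := by
  have h := (contDiffAt_chartMul_left hx).differentiableAt (by simp)
  exact (DifferentiableAt.comp (f := fun y => (y, x)) (idCoord E G) h (by fun_prop)).hasFDerivAt

theorem hasFDerivAt_chartConj {x : E} (hx : x ∈ (idChart E G).target) :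
    HasFDerivAt (chartConj G x) (chartAd G x) (idCoord E G) := by
  have h := (contDiffAt_chartConj_right hx).differentiableAt (by simp)
  exact (DifferentiableAt.comp (f := fun y => (x, y)) (idCoord E G) h (by fun_prop)).hasFDerivAt

theorem contDiffAt_chartLeft {x : E} (hx : x ∈ (idChart E G).target) :
    ContDiffAt ℝ ∞ (chartLeft (E := E) G) x :=
  (contDiffAt_chartMul_right hx).fderiv contDiffAt_const (by simp)

theorem contDiffAt_chartRight {x : E} (hx : x ∈ (idChart E G).target) :
    ContDiffAt ℝ ∞ (chartRight (E := E) G) x := by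
  refine ContDiffAt.fderiv (n := ∞) (f := fun x y => chartMul G y x) ?_ contDiffAt_const (by simp)
  exact ContDiffAt.comp (g := Function.uncurry (chartMul (E := E) G))
    (f := fun p : E × E => (p.2, p.1)) (x, idCoord E G) (contDiffAt_chartMul_left hx)
    (contDiffAt_snd.prodMk contDiffAt_fst)

theorem contDiffAt_chartAd {x : E} (hx : x ∈ (idChart E G).target) :
    ContDiffAt ℝ ∞ (chartAd (E := E) G) x :=
  (contDiffAt_chartConj_right hx).fderiv contDiffAt_const (by simp)

/-- `chartLeft G x` is the partial differential of the product in its second argument, so its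
derivative in `x` is a mixed second derivative. With the same for `chartRight`, symmetry of second
derivatives links the two. -/
theorem fderiv_chartLeft (v w : E) : fderiv ℝ (chartLeft G) (idCoord E G) v w =
    fderiv ℝ (fderiv ℝ (Function.uncurry (chartMul (E := E) G))) (idCoord E G, idCoord E G)
      (v, 0) (0, w) := by
  have h : chartLeft G =ᶠ[𝓝 (idCoord E G)] fun x =>
      (fderiv ℝ (Function.uncurry (chartMul (E := E) G)) (x, idCoord E G)).comp
        (ContinuousLinearMap.inr ℝ E E) := by
    filter_upwards [target_mem_nhds] with x hx
    have h := ((contDiffAt_chartMul_right hx).differentiableAt (by simp)).hasFDerivAt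
    exact (HasFDerivAt.comp (f := fun y => (x, y)) (idCoord E G) h
      (hasFDerivAt_prodMk_right x (idCoord E G))).fderiv
  have h2 := ((contDiffAt_chartMul_right (idCoord_mem_target (E := E) (G := G))).fderiv_right
    (m := ∞) (by simp)).differentiableAt (by simp)
  have h3 := (HasFDerivAt.comp (f := fun x => (x, idCoord E G)) (idCoord E G) h2.hasFDerivAt
      (hasFDerivAt_prodMk_left _ _)).clm_comp
        (hasFDerivAt_const (ContinuousLinearMap.inr ℝ E E) (idCoord E G))
  rw [(h3.congr_of_eventuallyEq h).fderiv]
  simp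

theorem fderiv_chartRight (v w : E) : fderiv ℝ (chartRight G) (idCoord E G) v w =
    fderiv ℝ (fderiv ℝ (Function.uncurry (chartMul (E := E) G))) (idCoord E G, idCoord E G)
      (0, v) (w, 0) := by
  have h : chartRight G =ᶠ[𝓝 (idCoord E G)] fun x =>
      (fderiv ℝ (Function.uncurry (chartMul (E := E) G)) (idCoord E G, x)).comp
        (ContinuousLinearMap.inl ℝ E E) := by
    filter_upwards [target_mem_nhds] with x hx
    have h := ((contDiffAt_chartMul_left hx).differentiableAt (by simp)).hasFDerivAt
    exact (HasFDerivAt.comp (f := fun y => (y, x)) (idCoord E G) h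
      (hasFDerivAt_prodMk_left (idCoord E G) x)).fderiv
  have h2 := ((contDiffAt_chartMul_right (idCoord_mem_target (E := E) (G := G))).fderiv_right
    (m := ∞) (by simp)).differentiableAt (by simp)
  have h3 := (HasFDerivAt.comp (f := fun x => (idCoord E G, x)) (idCoord E G) h2.hasFDerivAt
      (hasFDerivAt_prodMk_right _ _)).clm_comp
        (hasFDerivAt_const (ContinuousLinearMap.inl ℝ E E) (idCoord E G))
  rw [(h3.congr_of_eventuallyEq h).fderiv]
  simp

theorem fderiv_chartRight_eq_chartLeft (v w : E) :
    fderiv ℝ (chartRight G) (idCoord E G) v w = fderiv ℝ (chartLeft G) (idCoord E G) w v := by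
  rw [fderiv_chartRight, fderiv_chartLeft]
  exact ((contDiffAt_chartMul_right (idCoord_mem_target (E := E) (G := G))).isSymmSndFDerivAt
    (by simpa using ENat.LEInfty.out)).eq _ _

/-- Differentiate `(x y x⁻¹) x = x y` at `y = 1`. In coordinates this holds only while `x y x⁻¹`
stays in the chart domain, hence the continuity argument. -/
theorem chartRight_comp_chartAd {x : E} (hx : x ∈ (idChart E G).target) :
    (chartRight G x).comp (chartAd G x) = chartLeft G x := by
  have h1 := HasFDerivAt.comp (g := fun y => chartMul G y x) (idCoord E G)
    (by rw [chartConj_idCoord]; exact hasFDerivAt_chartMul_left hx) (hasFDerivAt_chartConj hx)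
  refine h1.unique ((hasFDerivAt_chartMul_right hx).congr_of_eventuallyEq ?_)
  have hc : ContinuousAt (fun y => (idChart E G).symm x * (idChart E G).symm y *
      ((idChart E G).symm x)⁻¹) (idCoord E G) :=
    ((contMDiffAt_const.mul (contMDiffAt_idChart_symm idCoord_mem_target)).mul
      (contMDiffAt_const (I' := 𝓘(ℝ, E)) (n := ∞))).continuousAt
  have hs := hc.preimage_mem_nhds ((idChart E G).open_source.mem_nhds (by
    rw [symm_idCoord, mul_one, mul_inv_cancel]
    exact one_mem_source))
  filter_upwards [hs] with y hy
  simp only [Function.comp, chartMul, chartConj]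
  rw [(idChart E G).left_inv hy, inv_mul_cancel_right]

/-- The differential of the adjoint action in the chart at the identity. -/
theorem fderiv_chartAd (v w : E) : fderiv ℝ (chartAd G) (idCoord E G) v w =
    fderiv ℝ (chartLeft G) (idCoord E G) v w - fderiv ℝ (chartLeft G) (idCoord E G) w v := by
  have hA := ((contDiffAt_chartAd (idCoord_mem_target (E := E) (G := G))).differentiableAt
    (by simp)).hasFDerivAt
  have hR := ((contDiffAt_chartRight (idCoord_mem_target (E := E) (G := G))).differentiableAt
    (by simp)).hasFDerivAt
  -- Product rule for `chartRight ∘ chartAd = chartLeft` at the identity, where both factors are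
  -- `id`: the derivatives of `chartRight` and `chartAd` add up to that of `chartLeft`.
  have h := (hR.clm_comp hA).congr_of_eventuallyEq (f₁ := chartLeft G)
    (Filter.mem_of_superset target_mem_nhds fun x hx => (chartRight_comp_chartAd hx).symm)
  rw [← fderiv_chartRight_eq_chartLeft v w, h.fderiv, chartRight_idCoord, chartAd_idCoord]
  simp

theorem Ad_eq_mfderiv (g : G) :
    Ad E g = (mfderiv 𝓘(ℝ, E) 𝓘(ℝ, E) (fun z : G => g * (z * g⁻¹)) 1 : E →L[ℝ] E) := by
  have h := mfderiv_comp (1 : G) (mdifferentiableAt_mul_left (E := E) g (1 * g⁻¹))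
    (mdifferentiableAt_mul_right (E := E) g⁻¹ 1)
  refine Eq.trans ?_ h.symm
  rw [Ad]
  exact congrArg (fun a => (dLeft E g a).comp (dRight E g⁻¹ 1)) (one_mul g⁻¹).symm

theorem Ad_symm (x : E) : Ad E ((idChart E G).symm x) = chartAd G x := by
  rw [Ad_eq_mfderiv, mfderiv_eq_fderiv_idChart ?_ (by simp)]
  · unfold chartAd chartConj
    simp_rw [mul_assoc]
  · exact ((contMDiffAt_const.mul (contMDiffAt_id.mul contMDiffAt_const)).mdifferentiableAt
      (n := ∞) (by simp))

theorem Ad_eq_chartAd {g : G} (hg : g ∈ (idChart E G).source) :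
    Ad E g = chartAd G (idChart E G g) := by
  rw [← Ad_symm, (idChart E G).left_inv hg]

end

/-! ### Curves in a subgroup; the bracket as the derivative of `Ad` -/

section

open Filter Topology

variable {E : Type*} [NormedAddCommGroup E] [NormedSpace ℝ E]
  {G : Type*} [TopologicalSpace G] [ChartedSpace E G] [Group G]

theorem hasMFDerivAt_curve_iff {γ : ℝ → G} (h0 : γ 0 = 1) (hc : ContinuousAt γ 0) (x : E) :
    HasMFDerivAt 𝓘(ℝ, ℝ) 𝓘(ℝ, E) γ 0 (ContinuousLinearMap.toSpanSingleton ℝ x : ℝ →L[ℝ] E) ↔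
      HasDerivAt (fun t => idChart E G (γ t)) x 0 := by
  have e : HasMFDerivAt 𝓘(ℝ, ℝ) 𝓘(ℝ, E) γ 0
      (ContinuousLinearMap.toSpanSingleton ℝ x : ℝ →L[ℝ] E) ↔ ContinuousAt γ 0 ∧
      HasFDerivWithinAt (writtenInExtChartAt 𝓘(ℝ, ℝ) 𝓘(ℝ, E) 0 γ)
        (ContinuousLinearMap.toSpanSingleton ℝ x : ℝ →L[ℝ] E) (Set.range 𝓘(ℝ, ℝ))
        (extChartAt 𝓘(ℝ, ℝ) (0 : ℝ) 0) := Iff.rfl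
  rw [e, hasDerivAt_iff_hasFDerivAt]
  simp [writtenInExtChartAt, h0, Function.comp_def, hc]
  rfl

section LieGroup

variable [LieGroup 𝓘(ℝ, E) ∞ G]

theorem mem_lieSubspace_iff (H : Subgroup G) (x : E) :
    x ∈ lieSubspace E H ↔ ∃ γ : ℝ → G, ContMDiff 𝓘(ℝ, ℝ) 𝓘(ℝ, E) ∞ γ ∧ (∀ t, γ t ∈ H) ∧
      γ 0 = 1 ∧ HasDerivAt (fun t => idChart E G (γ t)) x 0 := by
  constructor
  · rintro ⟨y, ⟨γ, hγ, hγH, hy⟩, rfl⟩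
    obtain ⟨h0, h⟩ := (tangentMap_curve_iff (E := E) hγ y).1 hy
    exact ⟨γ, hγ, hγH, h0, (hasMFDerivAt_curve_iff (E := E) h0 (hγ 0).continuousAt y).1 h⟩
  · rintro ⟨γ, hγ, hγH, h0, h⟩
    have hx := (tangentMap_curve_iff hγ x).2
      ⟨h0, (hasMFDerivAt_curve_iff h0 (hγ 0).continuousAt x).2 h⟩
    exact ⟨x, ⟨γ, hγ, hγH, hx⟩, rfl⟩

theorem mfderiv_extChartAt_self :
    (mfderiv 𝓘(ℝ, E) 𝓘(ℝ, E) (extChartAt 𝓘(ℝ, E) (1 : G)) 1 : E →L[ℝ] E) =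
      ContinuousLinearMap.id ℝ E := by
  have h : MDifferentiableAt 𝓘(ℝ, E) 𝓘(ℝ, E) (extChartAt 𝓘(ℝ, E) (1 : G)) 1 :=
    mdifferentiableAt_extChartAt (mem_chart_source E (1 : G))
  refine Eq.trans h.mfderiv ?_
  have e : writtenInExtChartAt 𝓘(ℝ, E) 𝓘(ℝ, E) 1 (extChartAt 𝓘(ℝ, E) (1 : G)) =ᶠ[𝓝 (idCoord E G)]
      id := by
    filter_upwards [target_mem_nhds] with x hx
    simp [writtenInExtChartAt, (idChart E G).right_inv hx]
    rfl
  simp only [modelWithCornersSelf_coe, Set.range_id, fderivWithin_univ]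
  exact e.fderiv_eq.trans fderiv_id

/-- In the chart at the identity, the left invariant vector field given by `v` is
`x ↦ chartLeft G x v`. -/
theorem mpullbackWithin_mulInvariantVectorField (v : GroupLieAlgebra 𝓘(ℝ, E) G) {x : E}
    (hx : x ∈ (idChart E G).target) :
    (VectorField.mpullbackWithin 𝓘(ℝ, E) 𝓘(ℝ, E) (extChartAt 𝓘(ℝ, E) (1 : G)).symm
      (mulInvariantVectorField v) (Set.range 𝓘(ℝ, E)) x : E) =
      chartLeft G x (tangentCoord E (1 : G) v) := by
  have hx' : x ∈ (extChartAt 𝓘(ℝ, E) (1 : G)).target := by simpa using hx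
  have h1 := mfderiv_extChartAt_comp_mfderivWithin_extChartAt_symm (I := 𝓘(ℝ, E)) hx'
  have h2 := mfderivWithin_extChartAt_symm_comp_mfderiv_extChartAt (I := 𝓘(ℝ, E)) hx'
  -- The inverse of the differential of the inverse chart is the differential of the chart, so by
  -- the chain rule the pullback is the differential of the chart composed with left translation.
  rw [VectorField.mpullbackWithin_apply, ContinuousLinearMap.inverse_eq h2 h1]
  generalize hg : (extChartAt 𝓘(ℝ, E) (1 : G)).symm x = g
  have hgs : g * 1 ∈ (chartAt E (1 : G)).source := by
    rw [mul_one, ← hg]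
    exact (idChart E G).map_target hx
  have hd : MDifferentiableAt 𝓘(ℝ, E) 𝓘(ℝ, E) (extChartAt 𝓘(ℝ, E) (1 : G)) (g * 1) :=
    mdifferentiableAt_extChartAt hgs
  have h3 := mfderiv_comp (1 : G) hd (mdifferentiableAt_mul_left (E := E) g 1)
  have h4 := (hd.comp (1 : G) (mdifferentiableAt_mul_left (E := E) g 1)).mfderiv
  have h5 : (mfderiv 𝓘(ℝ, E) 𝓘(ℝ, E) (extChartAt 𝓘(ℝ, E) (1 : G) ∘ fun z : G => g * z) 1 :
      E →L[ℝ] E) = chartLeft G x := by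
    refine Eq.trans h4 ?_
    subst hg
    simp [writtenInExtChartAt, Function.comp_def, chartLeft]
    rfl
  rw [← h5]
  have h6 := DFunLike.congr_fun h3 v
  refine Eq.trans ?_ h6.symm
  exact congrArg (fun a : G => (mfderiv 𝓘(ℝ, E) 𝓘(ℝ, E) (extChartAt 𝓘(ℝ, E) (1 : G)) a : E →L[ℝ] E)
    (dLeft E g 1 (v : E))) (mul_one g).symm

/-- In the chart the two fields are `x ↦ chartLeft G x v` and `x ↦ chartLeft G x w`, with values `v`
and `w` at the identity. Their bracket there is the antisymmetrised derivative of `chartLeft`, which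
`fderiv_chartAd` identifies. -/
theorem tangentCoord_bracket (v w : GroupLieAlgebra 𝓘(ℝ, E) G) :
    tangentCoord E (1 : G) ⁅v, w⁆ =
      fderiv ℝ (chartAd G) (idCoord E G) (tangentCoord E (1 : G) v) (tangentCoord E (1 : G) w) := by
  rw [fderiv_chartAd]
  have hL := ((contDiffAt_chartLeft (idCoord_mem_target (E := E) (G := G))).differentiableAt
    (by simp)).hasFDerivAt
  have hf : ∀ u : GroupLieAlgebra 𝓘(ℝ, E) G,
      (VectorField.mpullbackWithin 𝓘(ℝ, E) 𝓘(ℝ, E) (extChartAt 𝓘(ℝ, E) (1 : G)).symm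
      (mulInvariantVectorField u) (Set.range 𝓘(ℝ, E)) : E → E) =ᶠ[𝓝 (idCoord E G)]
        fun x => chartLeft G x (tangentCoord E (1 : G) u) := fun u =>
    Filter.mem_of_superset target_mem_nhds fun x hx =>
      mpullbackWithin_mulInvariantVectorField u hx
  have hd : ∀ u : E, HasFDerivAt (fun x => chartLeft G x u)
      ((fderiv ℝ (chartLeft G) (idCoord E G)).flip u) (idCoord E G) := fun u => by
    simpa using hL.clm_apply (hasFDerivAt_const u (idCoord E G))
  have hb : ∀ V W : E → E, (V =ᶠ[𝓝 (idCoord E G)] fun x => chartLeft G x (tangentCoord E (1 : G) v)) →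
      (W =ᶠ[𝓝 (idCoord E G)] fun x => chartLeft G x (tangentCoord E (1 : G) w)) →
      VectorField.lieBracket ℝ V W (idCoord E G) =
      fderiv ℝ (chartLeft G) (idCoord E G) (tangentCoord E (1 : G) v) (tangentCoord E (1 : G) w) -
      fderiv ℝ (chartLeft G) (idCoord E G) (tangentCoord E (1 : G) w)
        (tangentCoord E (1 : G) v) := by
    intro V W hV hW
    rw [VectorField.lieBracket, hV.fderiv_eq, hW.fderiv_eq, hV.eq_of_nhds,
      hW.eq_of_nhds, (hd _).fderiv, (hd _).fderiv, chartLeft_idCoord]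
    rfl
  rw [← hb _ _ (hf v) (hf w), GroupLieAlgebra.bracket_def]
  have h1 := VectorField.mlieBracketWithin_apply (I := 𝓘(ℝ, E)) (V := mulInvariantVectorField v)
    (W := mulInvariantVectorField w) (s := Set.univ) (x₀ := (1 : G))
  have h2 : ((mfderiv 𝓘(ℝ, E) 𝓘(ℝ, E) (extChartAt 𝓘(ℝ, E) (1 : G)) 1 : E →L[ℝ] E)).inverse =
      ContinuousLinearMap.id ℝ E := by
    rw [mfderiv_extChartAt_self]
    exact ContinuousLinearMap.inverse_id
  have h3 : (extChartAt 𝓘(ℝ, E) (1 : G)).symm ⁻¹' Set.univ ∩ Set.range 𝓘(ℝ, E) = Set.univ := by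
    simp
  rw [h3] at h1
  refine Eq.trans h1 (Eq.trans (DFunLike.congr_fun (F := E →L[ℝ] E) h2 _) ?_)
  exact congrFun VectorField.lieBracketWithin_univ _

theorem hasDerivAt_Ad {γ : ℝ → G} (hγ : ContinuousAt γ 0) (h0 : γ 0 = 1) {x : E}
    (h : HasDerivAt (fun t => idChart E G (γ t)) x 0) :
    HasDerivAt (fun t => Ad E (γ t)) (fderiv ℝ (chartAd G) (idCoord E G) x) 0 := by
  have hA := ((contDiffAt_chartAd (idCoord_mem_target (E := E) (G := G))).differentiableAt
    (by simp)).hasFDerivAt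
  have h1 : HasDerivAt (fun t => chartAd G (idChart E G (γ t)))
      (fderiv ℝ (chartAd G) (idCoord E G) x) 0 :=
    HasFDerivAt.comp_hasDerivAt (l := chartAd (E := E) G) 0 (by rw [h0]; exact hA) h
  refine h1.congr_of_eventuallyEq ?_
  have := hγ.preimage_mem_nhds ((idChart E G).open_source.mem_nhds (by
    rw [h0]
    exact one_mem_source))
  filter_upwards [this] with t ht
  exact Ad_eq_chartAd ht

theorem Ad_one : Ad E (1 : G) = ContinuousLinearMap.id ℝ E := by
  rw [Ad_eq_chartAd one_mem_source, chartAd_idCoord]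

theorem Ad_mul (g h : G) : Ad E (g * h) = (Ad E g).comp (Ad E h) := by
  have hs : ∀ g : G, MDifferentiableAt 𝓘(ℝ, E) 𝓘(ℝ, E) (fun z : G => g * (z * g⁻¹)) 1 :=
    fun g => ((contMDiffAt_const.mul (contMDiffAt_id.mul contMDiffAt_const)).mdifferentiableAt
      (n := ∞) (by simp))
  have h1 : ∀ g : G, g * (1 * g⁻¹) = 1 := by simp
  simp only [Ad_eq_mfderiv]
  have h2 := mfderiv_comp (1 : G) (g := fun z : G => g * (z * g⁻¹)) (by rw [h1]; exact hs g) (hs h)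
  refine Eq.trans ?_ (Eq.trans h2 ?_)
  · congr 1
    ext z
    simp [mul_assoc]
  · have h3 : ∀ a b : G, a = b →
        (mfderiv 𝓘(ℝ, E) 𝓘(ℝ, E) (fun z : G => g * (z * g⁻¹)) a : E →L[ℝ] E) =
          mfderiv 𝓘(ℝ, E) 𝓘(ℝ, E) (fun z : G => g * (z * g⁻¹)) b := by
      rintro a _ rfl
      rfl
    exact congrArg (fun A : E →L[ℝ] E => (A.comp (mfderiv 𝓘(ℝ, E) 𝓘(ℝ, E)
      (fun z : G => h * (z * h⁻¹)) 1 : E →L[ℝ] E) : E →L[ℝ] E)) (h3 _ _ (h1 h))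

/-- Conjugating by `g` a curve in `H` with velocity `x` gives a curve in `H` with velocity `Ad_g x`.
-/
theorem Ad_mem_lieSubspace {H : Subgroup G} {g : G} (hg : g ∈ H) {x : E}
    (hx : x ∈ lieSubspace E H) : Ad E g x ∈ lieSubspace E H := by
  rw [mem_lieSubspace_iff] at hx ⊢
  obtain ⟨γ, hγ, hγH, h0, h⟩ := hx
  refine ⟨fun t => g * γ t * g⁻¹, (contMDiff_const.mul hγ).mul contMDiff_const,
    fun t => H.mul_mem (H.mul_mem hg (hγH t)) (H.inv_mem hg), by simp [h0], ?_⟩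
  have hf : DifferentiableAt ℝ (fun y => idChart E G (g * ((idChart E G).symm y * g⁻¹)))
      (idCoord E G) := by
    refine (contDiffAt_idChart_comp (contMDiffAt_const.mul ((contMDiffAt_idChart_symm
      idCoord_mem_target).mul contMDiffAt_const)) ?_).differentiableAt (by simp)
    change g * ((idChart E G).symm (idCoord E G) * g⁻¹) ∈ _
    rw [symm_idCoord]
    simp
  have hA : Ad E g = fderiv ℝ (fun y => idChart E G (g * ((idChart E G).symm y * g⁻¹)))
      (idCoord E G) := by
    rw [Ad_eq_mfderiv, mfderiv_eq_fderiv_idChart ?_ (by simp)]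
    exact ((contMDiffAt_const.mul (contMDiffAt_id.mul contMDiffAt_const)).mdifferentiableAt
      (n := ∞) (by simp))
  have h1 := HasFDerivAt.comp_hasDerivAt (0 : ℝ) (by rw [h0]; exact hf.hasFDerivAt) h
  rw [hA]
  refine h1.congr_of_eventuallyEq ?_
  have := (hγ 0).continuousAt.preimage_mem_nhds ((idChart E G).open_source.mem_nhds (by
    rw [h0]
    exact one_mem_source))
  filter_upwards [this] with t ht
  simp only [Function.comp]
  rw [(idChart E G).left_inv ht, mul_assoc]

end LieGroup

/-- The operator `ad_x` in the coordinates of the model space. -/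
theorem coord_adBivector [FiniteDimensional ℝ E] [LieGroup 𝓘(ℝ, E) ∞ G]
    (x : GroupLieAlgebra 𝓘(ℝ, E) G) (b : BivectorAt E (1 : G)) :
    coord 1 (adBivector x b) = derivationExt
      (fderiv ℝ (chartAd G) (idCoord E G) (tangentCoord E (1 : G) x)).toLinearMap (coord 1 b) :=
  bimap_derivationExt (fun w => tangentCoord_bracket x w) b

end

/-! ### The stabilizer of a bivector modulo `𝔥 ∧ 𝔤` -/

section

open Filter Topology

section Derivative

variable {E : Type*} [NormedAddCommGroup E] [NormedSpace ℝ E] [FiniteDimensional ℝ E]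

/-- The continuous bilinear form `(u, v) ↦ l (u ∧ v)`. -/
def wedgeForm (l : ⋀[ℝ]^2 E →ₗ[ℝ] ℝ) : E →L[ℝ] E →L[ℝ] ℝ :=
  LinearMap.toContinuousLinearMap (LinearMap.toContinuousLinearMap.toLinearMap ∘ₗ
    LinearMap.mk₂ ℝ (fun u v => l (wedge u v)) (fun a b c => by simp [wedge_add_left])
      (fun r a c => by simp [wedge_smul_left]) (fun a b c => by simp [wedge_add_right])
      (fun r a c => by simp [wedge_smul_right]))

theorem wedgeForm_apply (l : ⋀[ℝ]^2 E →ₗ[ℝ] ℝ) (u v : E) : wedgeForm l u v = l (wedge u v) := rfl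

/-- The product rule on decomposable bivectors. Composing with a functional `l` keeps everything
scalar, so `⋀² E` needs no topology. -/
theorem hasDerivAt_bimap (l : ⋀[ℝ]^2 E →ₗ[ℝ] ℝ) (b : ⋀[ℝ]^2 E) {A : ℝ → E →L[ℝ] E}
    {A' : E →L[ℝ] E} {t : ℝ} (hA : HasDerivAt A A' t) (hA1 : A t = ContinuousLinearMap.id ℝ E) :
    HasDerivAt (fun s => l (bimap (A s).toLinearMap b)) (l (derivationExt A'.toLinearMap b)) t := by
  induction b using bivector_induction with
  | zero => simpa using hasDerivAt_const t (0 : ℝ)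
  | add x y hx hy => simpa using hx.fun_add hy
  | smul c x hx => simpa using hx.const_mul c
  | wedge u v =>
    have hu : ∀ w, HasDerivAt (fun s => A s w) (A' w) t := fun w => by
      simpa using hA.clm_apply (hasDerivAt_const t w)
    have h := ((wedgeForm l).hasFDerivAt.comp_hasDerivAt t (hu u)).clm_apply (hu v)
    simpa [bimap_wedge, derivationExt_wedge, wedgeForm_apply, hA1, Function.comp_def] using h

end Derivative

/-- A subspace is the common kernel of the functionals vanishing on it. This turns membership in `𝔥
∧ 𝔤` into scalar equations, which can be differentiated and are closed conditions. -/
theorem mem_of_forall_dual {V : Type*} [AddCommGroup V] [Module ℝ V] {W : Submodule ℝ V} {b : V}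
    (h : ∀ l : V →ₗ[ℝ] ℝ, (∀ w ∈ W, l w = 0) → l b = 0) : b ∈ W := by
  by_contra hb
  obtain ⟨l, hl, hW⟩ := Submodule.exists_le_ker_of_notMem hb
  exact hl (h l fun w hw => hW hw)

variable {E : Type*} [NormedAddCommGroup E] [NormedSpace ℝ E]
  {G : Type*} [TopologicalSpace G] [ChartedSpace E G] [Group G] [LieGroup 𝓘(ℝ, E) ∞ G]

theorem bimap_Ad_mul (g h : G) (b : ⋀[ℝ]^2 E) :
    bimap (Ad E (g * h)).toLinearMap b =
      bimap (Ad E g).toLinearMap (bimap (Ad E h).toLinearMap b) := by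
  rw [bimap_bimap, Ad_mul]
  rfl

theorem bimap_Ad_mem {H : Subgroup G} {g : G} (hg : g ∈ H) {b : ⋀[ℝ]^2 E}
    (hb : b ∈ wedgeTop (lieSubspace E H)) :
    bimap (Ad E g).toLinearMap b ∈ wedgeTop (lieSubspace E H) :=
  bimap_mem_wedgeTop (fun _ hx => Ad_mem_lieSubspace hg hx) hb

/-- The elements of `H` that fix the class of the bivector `b` modulo `𝔥 ∧ 𝔤`. -/
def classStabilizer (H : Subgroup G) (b : ⋀[ℝ]^2 E) : Subgroup G where
  carrier := {h | h ∈ H ∧ bimap (Ad E h).toLinearMap b - b ∈ wedgeTop (lieSubspace E H)}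
  one_mem' := ⟨H.one_mem, by simp [Ad_one, bimap_id]⟩
  mul_mem' := by
    rintro g h ⟨hg, hgb⟩ ⟨hh, hhb⟩
    refine ⟨H.mul_mem hg hh, ?_⟩
    -- The first summand stays in `𝔥 ∧ 𝔤` because `Ad_g`, for `g ∈ H`, preserves this subspace.
    have e : bimap (Ad E (g * h)).toLinearMap b - b =
        bimap (Ad E g).toLinearMap (bimap (Ad E h).toLinearMap b - b) +
          (bimap (Ad E g).toLinearMap b - b) := by
      rw [bimap_Ad_mul, map_sub]
      abel
    rw [e]
    exact add_mem (bimap_Ad_mem hg hhb) hgb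
  inv_mem' := by
    rintro g ⟨hg, hgb⟩
    refine ⟨H.inv_mem hg, ?_⟩
    have e : bimap (Ad E g⁻¹).toLinearMap b - b =
        -bimap (Ad E g⁻¹).toLinearMap (bimap (Ad E g).toLinearMap b - b) := by
      rw [map_sub, ← bimap_Ad_mul, inv_mul_cancel, Ad_one, bimap_coe_id]
      abel
    rw [e]
    exact neg_mem (bimap_Ad_mem (H.inv_mem hg) hgb)

theorem mem_classStabilizer {H : Subgroup G} {b : ⋀[ℝ]^2 E} {h : G} : h ∈ classStabilizer H b ↔
    h ∈ H ∧ bimap (Ad E h).toLinearMap b - b ∈ wedgeTop (lieSubspace E H) := Iff.rfl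

theorem isCoisotropic_translated_iff_le {π : ∀ g : G, BivectorAt E g} (hπ : IsPoissonLie π)
    {H : Subgroup G} (hH : IsCoisotropic π H) (σ : G) :
    IsCoisotropic (translated π σ) H ↔
      H ≤ classStabilizer H (coord 1 (translationBivector π σ)) := by
  rw [isCoisotropic_translated_iff hπ hH]
  constructor
  · intro h g hg
    refine ⟨hg, ?_⟩
    have := h g⁻¹ (H.inv_mem hg)
    rwa [inv_inv, ← neg_mem_iff, neg_sub] at this
  · intro h g hg
    rw [← neg_mem_iff, neg_sub]
    exact (h (H.inv_mem hg)).2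

variable [FiniteDimensional ℝ E]

/-- The chart gives continuity at the identity only. At `g` one writes `Ad_h = Ad_g Ad_{g⁻¹h}` and
absorbs `Ad_g` into the functional, which is why `h1` is stated for all `l`. -/
theorem continuous_bimap_Ad (l : ⋀[ℝ]^2 E →ₗ[ℝ] ℝ) (b : ⋀[ℝ]^2 E) :
    Continuous fun g : G => l (bimap (Ad E g).toLinearMap b) := by
  have := topologicalGroup_of_lieGroup 𝓘(ℝ, E) ∞ (G := G)
  have hA : ContinuousAt (fun g : G => Ad E g) 1 := by
    have h1 : ContinuousAt (fun g : G => chartAd G (idChart E G g)) 1 :=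
      ContinuousAt.comp (g := chartAd (E := E) G) (f := idChart E G)
        (contDiffAt_chartAd idCoord_mem_target).continuousAt
        ((idChart E G).continuousAt one_mem_source)
    refine h1.congr ?_
    filter_upwards [(idChart E G).open_source.mem_nhds one_mem_source] with g hg
    exact (Ad_eq_chartAd hg).symm
  have h1 : ∀ (l : ⋀[ℝ]^2 E →ₗ[ℝ] ℝ) (b : ⋀[ℝ]^2 E),
      ContinuousAt (fun g : G => l (bimap (Ad E g).toLinearMap b)) 1 := by
    intro l b
    induction b using bivector_induction with
    | zero => simpa using continuousAt_const
    | add x y hx hy => simpa using hx.fun_add hy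
    | smul c x hx => simpa using continuousAt_const.fun_mul hx
    | wedge u v =>
      have hu : ∀ w, ContinuousAt (fun g : G => Ad E g w) 1 := fun w =>
        hA.clm_apply continuousAt_const
      have h := ((wedgeForm l).continuous.continuousAt.comp (hu u)).clm_apply (hu v)
      simpa [bimap_wedge, wedgeForm_apply, Function.comp_def] using h
  rw [continuous_iff_continuousAt]
  intro g
  have h2 : ContinuousAt (fun h : G => g⁻¹ * h) g := by fun_prop
  have h3 := ContinuousAt.comp (f := fun h : G => g⁻¹ * h) (x := g)
    (by rw [inv_mul_cancel]; exact h1 (l ∘ₗ bimap (Ad E g).toLinearMap) b) h2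
  refine h3.congr (Eventually.of_forall fun h => ?_)
  simp only [Function.comp, LinearMap.comp_apply]
  rw [← bimap_Ad_mul, mul_inv_cancel_left]

theorem isClosed_classStabilizer {H : Subgroup G} (hH : IsClosed (H : Set G)) (b : ⋀[ℝ]^2 E) :
    IsClosed (classStabilizer H b : Set G) := by
  have e : (classStabilizer H b : Set G) = (H : Set G) ∩
      ⋂ l : {l : ⋀[ℝ]^2 E →ₗ[ℝ] ℝ // ∀ w ∈ wedgeTop (lieSubspace E H), l w = 0},
        {g : G | l.1 (bimap (Ad E g).toLinearMap b) = l.1 b} := by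
    ext g
    simp only [SetLike.mem_coe, mem_classStabilizer, Set.mem_inter_iff, Set.mem_iInter,
      Set.mem_ofPred_eq]
    refine and_congr_right fun _ => ⟨fun h l => ?_, fun h => mem_of_forall_dual fun l hl => ?_⟩
    · have := l.2 _ h
      rwa [map_sub, sub_eq_zero] at this
    · rw [map_sub, h ⟨l, hl⟩, sub_self]
  rw [e]
  exact hH.inter (isClosed_iInter fun l =>
    isClosed_eq (continuous_bimap_Ad l.1 b) continuous_const)

/-- The derivative of the adjoint action on bivectors along a curve through the identity. -/
theorem hasDerivAt_bimap_Ad (l : ⋀[ℝ]^2 E →ₗ[ℝ] ℝ) (b : ⋀[ℝ]^2 E) {γ : ℝ → G}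
    (hγ : ContinuousAt γ 0) (h0 : γ 0 = 1) {x : E}
    (h : HasDerivAt (fun t => idChart E G (γ t)) x 0) :
    HasDerivAt (fun t => l (bimap (Ad E (γ t)).toLinearMap b))
      (l (derivationExt (fderiv ℝ (chartAd G) (idCoord E G) x).toLinearMap b)) 0 :=
  hasDerivAt_bimap l b (hasDerivAt_Ad hγ h0 h) (by rw [h0, Ad_one])

/-- For `l` vanishing on `𝔥 ∧ 𝔤`, the function `l(Ad_{γ(t)} b)` is constant along a curve in `H`
with velocity `x`, and its derivative at `0` is `l(ad_x b)`. -/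
theorem derivationExt_mem_of_le {H : Subgroup G} {b : ⋀[ℝ]^2 E} (hb : H ≤ classStabilizer H b)
    {x : E} (hx : x ∈ lieSubspace E H) :
    derivationExt (fderiv ℝ (chartAd G) (idCoord E G) x).toLinearMap b ∈
      wedgeTop (lieSubspace E H) := by
  refine mem_of_forall_dual fun l hl => ?_
  obtain ⟨γ, hγ, hγH, h0, h⟩ := (mem_lieSubspace_iff H x).1 hx
  have h1 := hasDerivAt_bimap_Ad l b (hγ 0).continuousAt h0 h
  have h2 : (fun t => l (bimap (Ad E (γ t)).toLinearMap b)) = fun _ => l b := by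
    funext t
    have := hl _ (hb (hγH t)).2
    rwa [map_sub, sub_eq_zero] at this
  rw [h2] at h1
  exact h1.unique (hasDerivAt_const _ _)

/-- Write `γ(s + r) = γ(s) δ(r)` with `δ` a curve in `H` through the identity. The derivative of
`l(Ad_γ b)` at `s` is then `l(Ad_{γ(s)} ad_x b)` with `x = δ'(0) ∈ 𝔥`, and this vanishes since
`Ad_{γ(s)}` preserves `𝔥 ∧ 𝔤`. -/
theorem curve_mem_classStabilizer {H : Subgroup G} {b : ⋀[ℝ]^2 E}
    (hb : ∀ x ∈ lieSubspace E H, derivationExt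
      (fderiv ℝ (chartAd G) (idCoord E G) x).toLinearMap b ∈ wedgeTop (lieSubspace E H))
    {γ : ℝ → G} (hγ : ContMDiff 𝓘(ℝ, ℝ) 𝓘(ℝ, E) ∞ γ) (hγH : ∀ t, γ t ∈ H) (h0 : γ 0 = 1) (t : ℝ) :
    γ t ∈ classStabilizer H b := by
  refine ⟨hγH t, mem_of_forall_dual fun l hl => ?_⟩
  have hd : ∀ s, HasDerivAt (fun t => l (bimap (Ad E (γ t)).toLinearMap b)) 0 s := by
    intro s
    let δ : ℝ → G := fun r => (γ s)⁻¹ * γ (s + r)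
    have hδ : ContMDiff 𝓘(ℝ, ℝ) 𝓘(ℝ, E) ∞ δ :=
      contMDiff_const.mul (hγ.comp (contDiff_const.add contDiff_id).contMDiff)
    have hδH : ∀ r, δ r ∈ H := fun r => H.mul_mem (H.inv_mem (hγH s)) (hγH _)
    have hδ0 : δ 0 = 1 := by simp [δ]
    have hd : DifferentiableAt ℝ (fun r => idChart E G (δ r)) 0 :=
      (contDiffAt_idChart_comp (hδ 0) (by rw [hδ0]; exact one_mem_source)).differentiableAt
        (by simp)
    have hx := hb _ ((mem_lieSubspace_iff H _).2 ⟨δ, hδ, hδH, hδ0, hd.hasDerivAt⟩)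
    have h1 := hasDerivAt_bimap_Ad (l ∘ₗ bimap (Ad E (γ s)).toLinearMap) b (hδ 0).continuousAt hδ0
      hd.hasDerivAt
    rw [LinearMap.comp_apply, hl _ (bimap_Ad_mem (hγH s) hx)] at h1
    have h2 : HasDerivAt (fun t => l (bimap (Ad E (γ s)).toLinearMap
        (bimap (Ad E (δ (t - s))).toLinearMap b))) 0 s := by
      have h3 : HasDerivAt (fun t => t - s) 1 s := (hasDerivAt_id s).sub_const s
      have h4 := HasDerivAt.scomp s (by rw [sub_self]; exact h1) h3
      simpa [Function.comp_def] using h4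
    refine h2.congr_of_eventuallyEq (Eventually.of_forall fun t => ?_)
    simp only
    rw [← bimap_Ad_mul]
    simp [δ]
  have := is_const_of_deriv_eq_zero (fun s => (hd s).differentiableAt) (fun s => (hd s).deriv) t 0
  rw [map_sub, this, h0, Ad_one, bimap_coe_id, sub_self]

end

/-! ### Limit directions of a closed subgroup belong to its Lie algebra -/

section

open Filter Topology Metric

/-- An integral curve of a Lipschitz vector field which starts in a closed set stays in this set if
the vector field is tangent to the set. -/
theorem integralCurve_mem_of_tangent {E : Type*} [NormedAddCommGroup E] [NormedSpace ℝ E]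
    [ProperSpace E] {f : E → E} {K : NNReal} {Z : Set E} (hZ : IsClosed Z) {e : E} (he : e ∈ Z)
    {r : ℝ} (hf : LipschitzOnWith K f (closedBall e r))
    (hZf : ∀ p ∈ Z, p ∈ closedBall e r → ∃ (s : ℕ → ℝ) (y : ℕ → E), (∀ n, 0 < s n) ∧
      Tendsto s atTop (𝓝 0) ∧ (∀ᶠ n in atTop, y n ∈ Z) ∧
      Tendsto (fun n => (s n)⁻¹ • (y n - p)) atTop (𝓝 (f p)))
    {c : ℝ → E} {T : ℝ} (h0 : c 0 = e) (hc : ∀ t ∈ Set.Icc 0 T, HasDerivAt c (f (c t)) t)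
    (hcr : ∀ t ∈ Set.Icc 0 T, c t ∈ closedBall e (r / 2)) {t : ℝ} (ht : t ∈ Set.Icc 0 T) :
    c t ∈ Z := by
  have hne : Z.Nonempty := ⟨e, he⟩
  have hcont : ContinuousOn (fun t => infDist (c t) Z) (Set.Icc 0 T) := fun t ht =>
    ((continuous_infDist_pt Z).continuousAt.comp (hc t ht).continuousAt).continuousWithinAt
  -- The distance from `c` to `Z` grows at a rate of at most `K` times itself: compare `c` near `t`
  -- with points `y n` of `Z` leaving the nearest point `p` in direction `f p`; the velocities
  -- differ by at most `K * dist (c t) p`.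
  have key : ∀ t ∈ Set.Ico 0 T, ∀ ρ, K * infDist (c t) Z < ρ →
      ∃ᶠ u in 𝓝[>] t, (u - t)⁻¹ * (infDist (c u) Z - infDist (c t) Z) < ρ := by
    intro t ht ρ hρ
    have ht' : t ∈ Set.Icc 0 T := ⟨ht.1, ht.2.le⟩
    obtain ⟨p, hp, hpd⟩ := hZ.exists_infDist_eq_dist hne (c t)
    have hct := hcr t ht'
    rw [mem_closedBall] at hct
    -- `p` is no farther from `c t` than `e` is, so it lies within twice `r / 2` of `e`; hence the
    -- radius `r / 2` in `hcr`.
    have hpr : p ∈ closedBall e r := by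
      rw [mem_closedBall]
      have h1 : dist (c t) p ≤ dist (c t) e := hpd ▸ infDist_le_dist_of_mem he
      have h2 := dist_triangle_left p e (c t)
      linarith
    have hctr : c t ∈ closedBall e r := by
      rw [mem_closedBall]
      have := dist_nonneg (x := c t) (y := e)
      linarith
    obtain ⟨s, y, hs, hs0, hy, hlim⟩ := hZf p hp hpr
    have hlim2 : Tendsto (fun n => (s n)⁻¹ • (c (t + s n) - c t)) atTop (𝓝 (f (c t))) := by
      have := (hc t ht').hasFDerivAt.hasFDerivWithinAt (s := Set.univ).lim (c := fun n => (s n)⁻¹)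
        (d := s) (v := (1 : ℝ)) hs0 (by simp) (by
          refine tendsto_const_nhds.congr fun n => ?_
          simp [(hs n).ne'])
      simpa using this
    have hlim3 := (hlim2.sub hlim).norm
    have hlt : ‖f (c t) - f p‖ < ρ := by
      refine lt_of_le_of_lt ?_ hρ
      rw [hpd, ← dist_eq_norm]
      exact hf.dist_le_mul _ hctr _ hpr
    have hτ : Tendsto (fun n => t + s n) atTop (𝓝[>] t) := by
      rw [tendsto_nhdsWithin_iff]
      refine ⟨by simpa using hs0.const_add t, Eventually.of_forall fun n => ?_⟩
      simpa using hs n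
    refine hτ.frequently (Eventually.frequently ?_)
    filter_upwards [hlim3.eventually_lt_const hlt, hy] with n hn hyn
    refine lt_of_le_of_lt ?_ hn
    rw [← smul_sub, norm_smul, add_sub_cancel_left, Real.norm_of_nonneg (inv_nonneg.2 (hs n).le)]
    refine mul_le_mul_of_nonneg_left ?_ (inv_nonneg.2 (hs n).le)
    have h1 : infDist (c (t + s n)) Z ≤ ‖c (t + s n) - y n‖ := by
      rw [← dist_eq_norm]
      exact infDist_le_dist_of_mem hyn
    have h2 : ‖c (t + s n) - y n‖ ≤ ‖c (t + s n) - c t - (y n - p)‖ + ‖c t - p‖ := by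
      refine le_trans (le_of_eq ?_) (norm_add_le _ _)
      congr 1
      abel
    rw [hpd, dist_eq_norm]
    linarith
  -- Grönwall with initial distance `0` forces the distance to vanish throughout.
  have hle := le_gronwallBound_of_liminf_deriv_right_le hcont key (δ := 0) (K := K) (ε := 0)
    (by simp [h0, infDist_zero_of_mem he]) (by simp) t ht
  rw [gronwallBound_ε0_δ0] at hle
  exact (hZ.mem_iff_infDist_zero hne).2 (le_antisymm hle infDist_nonneg)

section

variable {E : Type*} [NormedAddCommGroup E]
  {G : Type*} [TopologicalSpace G] [ChartedSpace E G] [Group G]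

theorem tendsto_idChart {u : ℕ → G} (hu : Tendsto u atTop (𝓝 1)) :
    Tendsto (fun n => idChart E G (u n)) atTop (𝓝 (idCoord E G)) :=
  ((idChart E G).continuousAt one_mem_source).tendsto.comp hu

theorem eventually_mem_source {u : ℕ → G} (hu : Tendsto u atTop (𝓝 1)) :
    ∀ᶠ n in atTop, u n ∈ (idChart E G).source :=
  hu.eventually_mem ((idChart E G).open_source.mem_nhds one_mem_source)

end

variable {E : Type*} [NormedAddCommGroup E] [NormedSpace ℝ E]
  {G : Type*} [TopologicalSpace G] [ChartedSpace E G] [Group G]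

/-- `z` is the limit of the directions of a sequence in `H` which converges to the identity. -/
def IsTangent (H : Subgroup G) (z : E) : Prop :=
  ∃ (u : ℕ → G) (s : ℕ → ℝ), (∀ n, u n ∈ H) ∧ (∀ n, 0 < s n) ∧ Tendsto s atTop (𝓝 0) ∧
    Tendsto u atTop (𝓝 1) ∧
    Tendsto (fun n => (s n)⁻¹ • (idChart E G (u n) - idCoord E G)) atTop (𝓝 z)

/-- The differential quotients along a sequence of points converging to the identity. -/
theorem tendsto_smul_sub {F : Type*} [NormedAddCommGroup F] [NormedSpace ℝ F] {f : E → F}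
    {f' : E →L[ℝ] F} (hf : HasFDerivAt f f' (idCoord E G)) {u : ℕ → G} {s : ℕ → ℝ} {z : E}
    (hu : Tendsto u atTop (𝓝 1))
    (hz : Tendsto (fun n => (s n)⁻¹ • (idChart E G (u n) - idCoord E G)) atTop (𝓝 z)) :
    Tendsto (fun n => (s n)⁻¹ • (f (idChart E G (u n)) - f (idCoord E G))) atTop (𝓝 (f' z)) := by
  have := hf.hasFDerivWithinAt (s := Set.univ).lim
    (d := fun n => idChart E G (u n) - idCoord E G)
    (by simpa using (tendsto_idChart hu).sub_const (idCoord E G)) (by simp) hz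
  simpa using this

variable [LieGroup 𝓘(ℝ, E) ∞ G]

/-- Both partial differentials at the identity are `id`. This yields the differential of inversion
and, later, the cancellation `-w + w`. -/
theorem hasFDerivAt_chartMul : HasFDerivAt (Function.uncurry (chartMul (E := E) G))
    (ContinuousLinearMap.fst ℝ E E + ContinuousLinearMap.snd ℝ E E)
      (idCoord E G, idCoord E G) := by
  have h := ((contDiffAt_chartMul_right (idCoord_mem_target (E := E) (G := G))).differentiableAt
    (by simp)).hasFDerivAt
  have h1 := (HasFDerivAt.comp (f := fun y => (idCoord E G, y)) (idCoord E G) h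
    (hasFDerivAt_prodMk_right _ _)).unique (hasFDerivAt_chartMul_right idCoord_mem_target) |>.trans
      chartLeft_idCoord
  have h2 := (HasFDerivAt.comp (f := fun y => (y, idCoord E G)) (idCoord E G) h
    (hasFDerivAt_prodMk_left _ _)).unique (hasFDerivAt_chartMul_left idCoord_mem_target) |>.trans
      chartRight_idCoord
  have e : fderiv ℝ (Function.uncurry (chartMul (E := E) G)) (idCoord E G, idCoord E G) =
      ContinuousLinearMap.fst ℝ E E + ContinuousLinearMap.snd ℝ E E := by
    refine ContinuousLinearMap.ext fun v => ?_
    have e1 := DFunLike.congr_fun h2 v.1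
    have e2 := DFunLike.congr_fun h1 v.2
    have e3 : v = (v.1, 0) + (0, v.2) := by simp
    rw [e3, map_add]
    simp only [ContinuousLinearMap.comp_apply, ContinuousLinearMap.inl_apply,
      ContinuousLinearMap.inr_apply, ContinuousLinearMap.id_apply] at e1 e2
    rw [e1, e2]
    simp
  exact e ▸ h

theorem hasFDerivAt_chartInv : HasFDerivAt (fun y => idChart E G ((idChart E G).symm y)⁻¹)
    (-ContinuousLinearMap.id ℝ E) (idCoord E G) := by
  have hi : DifferentiableAt ℝ (fun y => idChart E G ((idChart E G).symm y)⁻¹) (idCoord E G) := by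
    refine (contDiffAt_idChart_comp (contMDiffAt_idChart_symm idCoord_mem_target).inv
      ?_).differentiableAt (by simp)
    rw [symm_idCoord, inv_one]
    exact one_mem_source
  have h1 := HasFDerivAt.comp (g := Function.uncurry (chartMul (E := E) G))
    (f := fun y => (y, idChart E G ((idChart E G).symm y)⁻¹)) (idCoord E G)
    (by rw [symm_idCoord, inv_one]; exact hasFDerivAt_chartMul)
    ((hasFDerivAt_id (idCoord E G)).prodMk hi.hasFDerivAt)
  have h2 : (Function.uncurry (chartMul (E := E) G) ∘
      fun y => (y, idChart E G ((idChart E G).symm y)⁻¹)) =ᶠ[𝓝 (idCoord E G)]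
        fun _ => idCoord E G := by
    have := topologicalGroup_of_lieGroup 𝓘(ℝ, E) ∞ (G := G)
    have hc : ContinuousAt (fun y => ((idChart E G).symm y)⁻¹) (idCoord E G) :=
      ((idChart E G).symm.continuousAt idCoord_mem_target).inv
    have hs := hc.preimage_mem_nhds ((idChart E G).open_source.mem_nhds (by
      rw [symm_idCoord, inv_one]
      exact one_mem_source))
    filter_upwards [hs] with y hy
    simp only [Function.comp, Function.uncurry, chartMul]
    rw [(idChart E G).left_inv hy, mul_inv_cancel]
  have h3 := h1.unique ((hasFDerivAt_const _ _).congr_of_eventuallyEq h2)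
  have h4 : fderiv ℝ (fun y => idChart E G ((idChart E G).symm y)⁻¹) (idCoord E G) =
      -ContinuousLinearMap.id ℝ E := by
    ext v
    have := DFunLike.congr_fun h3 v
    simpa [eq_neg_iff_add_eq_zero, add_comm] using this
  rw [← h4]
  exact hi.hasFDerivAt

theorem IsTangent.neg {H : Subgroup G} {z : E} (hz : IsTangent H z) : IsTangent H (-z) := by
  have := topologicalGroup_of_lieGroup 𝓘(ℝ, E) ∞ (G := G)
  obtain ⟨u, s, hu, hs, hs0, hu1, hz⟩ := hz
  refine ⟨fun n => (u n)⁻¹, s, fun n => H.inv_mem (hu n), hs, hs0, by simpa using hu1.inv, ?_⟩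
  have h := tendsto_smul_sub hasFDerivAt_chartInv hu1 hz
  rw [symm_idCoord, inv_one] at h
  refine (h.congr' ?_)
  filter_upwards [eventually_mem_source (E := E) hu1] with n hn
  rw [(idChart E G).left_inv hn]

/-- Left translation by a point of `H` carries a sequence of `H` at the identity to one at that
point, so the left invariant field given by `z` is tangent to `H` throughout the chart. -/
theorem IsTangent.exists_mul {H : Subgroup G} {z : E} (hz : IsTangent H z) {p : E}
    (hp : p ∈ (idChart E G).target) (hpH : (idChart E G).symm p ∈ H) :
    ∃ (s : ℕ → ℝ) (y : ℕ → E), (∀ n, 0 < s n) ∧ Tendsto s atTop (𝓝 0) ∧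
      Tendsto y atTop (𝓝 p) ∧ (∀ᶠ n in atTop, (idChart E G).symm (y n) ∈ H) ∧
      Tendsto (fun n => (s n)⁻¹ • (y n - p)) atTop (𝓝 (chartLeft G p z)) := by
  have := topologicalGroup_of_lieGroup 𝓘(ℝ, E) ∞ (G := G)
  obtain ⟨u, s, hu, hs, hs0, hu1, hz⟩ := hz
  have hd := hasFDerivAt_chartMul_right hp
  refine ⟨s, fun n => chartMul G p (idChart E G (u n)), hs, hs0, ?_, ?_, ?_⟩
  · have := hd.continuousAt.tendsto.comp (tendsto_idChart hu1)
    rwa [chartMul_idCoord hp] at this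
  · have h1 : Tendsto (fun n => (idChart E G).symm p * u n) atTop (𝓝 ((idChart E G).symm p)) := by
      simpa using hu1.const_mul ((idChart E G).symm p)
    filter_upwards [eventually_mem_source (E := E) hu1, h1.eventually_mem
      ((idChart E G).open_source.mem_nhds ((idChart E G).map_target hp))] with n hn hn2
    rw [chartMul, (idChart E G).left_inv hn, (idChart E G).left_inv hn2]
    exact H.mul_mem hpH (hu n)
  · have h := tendsto_smul_sub hd hu1 hz
    rwa [chartMul_idCoord hp] at h

variable [FiniteDimensional ℝ E]

/-- Near the identity, the integral curves of the left invariant vector fields tangent to a closed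
subgroup stay in this subgroup. -/
theorem IsTangent.integralCurve_mem {H : Subgroup G} (hH : IsClosed (H : Set G)) {z : E}
    (hz : IsTangent H z) {R r : ℝ} (hr : r < R) (hr0 : 0 ≤ r)
    (hR : closedBall (idCoord E G) R ⊆ (idChart E G).target) {K : NNReal}
    (hK : LipschitzOnWith K (fun x => chartLeft G x z) (closedBall (idCoord E G) R))
    {c : ℝ → E} {T : ℝ} (h0 : c 0 = idCoord E G)
    (hc : ∀ t ∈ Set.Icc 0 T, HasDerivAt c (chartLeft G (c t) z) t)
    (hcr : ∀ t ∈ Set.Icc 0 T, c t ∈ closedBall (idCoord E G) (r / 2)) {t : ℝ}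
    (ht : t ∈ Set.Icc 0 T) : (idChart E G).symm (c t) ∈ H := by
  have := FiniteDimensional.proper_real E
  -- Intersecting with a closed ball inside the chart target makes the trace of `H` closed in `E`.
  -- The strict inequality `r < R` keeps sequences converging to points of the smaller ball inside
  -- the larger one.
  have hclosed : IsClosed (closedBall (idCoord E G) R ∩ (idChart E G).symm ⁻¹' (H : Set G)) :=
    ((idChart E G).continuousOn_symm.mono hR).preimage_isClosed_of_isClosed isClosed_closedBall hH
  refine (integralCurve_mem_of_tangent hclosed ?_
    (hK.mono (closedBall_subset_closedBall hr.le)) ?_ h0 hc hcr ht).2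
  · refine ⟨mem_closedBall_self (by linarith), ?_⟩
    rw [Set.mem_preimage, symm_idCoord]
    exact H.one_mem
  · rintro p ⟨hpR, hpH⟩ hpr
    obtain ⟨s, y, hs, hs0, hy, hyH, hlim⟩ := hz.exists_mul (hR hpR) hpH
    refine ⟨s, y, hs, hs0, ?_, hlim⟩
    filter_upwards [hyH, hy.eventually_mem (isOpen_ball.mem_nhds
      (show p ∈ ball (idCoord E G) R from lt_of_le_of_lt hpr hr))] with n h1 h2
    exact ⟨ball_subset_closedBall h2, h1⟩

/-- The limit directions of a closed subgroup belong to its Lie algebra. -/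
theorem IsTangent.mem_lieSubspace {H : Subgroup G} (hH : IsClosed (H : Set G)) {z : E}
    (hz : IsTangent H z) : z ∈ lieSubspace E H := by
  have : CompleteSpace E := FiniteDimensional.complete ℝ E
  have hf : ∀ x ∈ (idChart E G).target, ContDiffAt ℝ ∞ (fun x => chartLeft G x z) x :=
    fun x hx => (contDiffAt_chartLeft hx).clm_apply contDiffAt_const
  have hfe := (hf _ idCoord_mem_target).of_le (m := 1) ENat.LEInfty.out
  obtain ⟨K, U, hU, hK⟩ := hfe.exists_lipschitzOnWith
  obtain ⟨R, hR, hRs⟩ := nhds_basis_closedBall.mem_iff.1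
    (inter_mem hU (target_mem_nhds (E := E) (G := G)))
  obtain ⟨c, h0, ε, hε, hc⟩ :=
    hfe.exists_forall_mem_closedBall_exists_eq_forall_mem_Ioo_hasDerivAt₀ 0
  simp only [zero_sub, zero_add] at hc
  have hcc : ContinuousAt c 0 := (hc 0 ⟨by linarith, hε⟩).continuousAt
  -- `IsTangent.integralCurve_mem` is used with `r = R / 2` and needs the curve within `r / 2`.
  obtain ⟨τ, hτ, hτs⟩ := nhds_basis_closedBall.mem_iff.1
    (hcc.preimage_mem_nhds (closedBall_mem_nhds _ (show 0 < R / 2 / 2 by positivity)))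
  rw [h0] at hτs
  obtain ⟨T, hT, hTε, hTτ⟩ : ∃ T > 0, T < ε ∧ T ≤ τ :=
    ⟨min (ε / 2) τ, by positivity, (min_le_left _ _).trans_lt (by linarith), min_le_right _ _⟩
  have hd : ∀ t ∈ Set.Icc (-T) T, HasDerivAt c (chartLeft G (c t) z) t := fun t ht =>
    hc t ⟨by linarith [ht.1], by linarith [ht.2]⟩
  have hr : ∀ t ∈ Set.Icc (-T) T, c t ∈ closedBall (idCoord E G) (R / 2 / 2) := fun t ht =>
    hτs (by
      rw [mem_closedBall, Real.dist_eq, sub_zero, abs_le]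
      exact ⟨by linarith [ht.1], by linarith [ht.2]⟩)
  have hrt : ∀ t ∈ Set.Icc (-T) T, c t ∈ (idChart E G).target := fun t ht =>
    (hRs (closedBall_subset_closedBall (by linarith) (hr t ht))).2
  have hcH : ∀ t ∈ Set.Icc (-T) T, (idChart E G).symm (c t) ∈ H := by
    have hl : LipschitzOnWith K (fun x => chartLeft G x z) (closedBall (idCoord E G) R) :=
      hK.mono fun x hx => (hRs hx).1
    have hl' : LipschitzOnWith K (fun x => chartLeft G x (-z)) (closedBall (idCoord E G) R) := by
      simp only [map_neg]
      exact hl.neg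
    intro t ht
    rcases le_total 0 t with h | h
    · exact hz.integralCurve_mem hH (half_lt_self hR) (by positivity) (fun x hx => (hRs hx).2)
        hl h0 (fun s hs => hd s ⟨by linarith [hs.1], hs.2⟩)
        (fun s hs => hr s ⟨by linarith [hs.1], hs.2⟩) ⟨h, ht.2⟩
    -- Negative times: `s ↦ c (-s)` is an integral curve for `-z`, again a limit direction of `H`.
    · have := hz.neg.integralCurve_mem hH (half_lt_self hR) (by positivity)
        (fun x hx => (hRs hx).2) hl' (c := fun s => c (-s)) (T := T)
        (by simpa using h0)
        (fun s hs => by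
          have h1 := hd (-s) ⟨by linarith [hs.2], by linarith [hs.1]⟩
          simpa [Function.comp_def] using h1.scomp s (hasDerivAt_neg s))
        (fun s hs => hr (-s) ⟨by linarith [hs.2], by linarith [hs.1]⟩)
        (t := -t) ⟨by linarith, by linarith [ht.1]⟩
      simpa using this
  have hcs : ContDiffOn ℝ ∞ c (Set.Icc (-T) T) := by
    refine ODE.contDiffOn_enat_Icc_of_hasDerivWithinAt (n := ⊤) (f := fun _ x => chartLeft G x z)
      (u := (idChart E G).target) ?_ (fun t ht => (hd t ht).hasDerivWithinAt) hrt
    rintro ⟨t, x⟩ ⟨-, hx⟩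
    exact (ContDiffAt.comp (g := fun x => chartLeft G x z) (f := Prod.snd) (t, x) (hf x hx)
      contDiffAt_snd).contDiffWithinAt
  -- The Lie algebra is defined by curves on all of `ℝ`. This reparametrisation maps `ℝ` smoothly
  -- into `[-T, T]`, fixes `0` and has derivative `1` there.
  have hsin : ∀ t : ℝ, T * Real.sin (t / T) ∈ Set.Icc (-T) T := fun t =>
    ⟨by nlinarith [Real.neg_one_le_sin (t / T)], by nlinarith [Real.sin_le_one (t / T)]⟩
  have hcomp : ContDiff ℝ ∞ (fun t : ℝ => c (T * Real.sin (t / T))) :=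
    hcs.comp_contDiff (by fun_prop) hsin
  rw [mem_lieSubspace_iff]
  refine ⟨fun t => (idChart E G).symm (c (T * Real.sin (t / T))), fun t => ?_,
    fun t => hcH _ (hsin t), by simp [h0], ?_⟩
  · exact (contMDiffAt_idChart_symm (hrt _ (hsin t))).comp t hcomp.contMDiff.contMDiffAt
  · have h1 : HasDerivAt (fun t : ℝ => T * Real.sin (t / T)) 1 0 := by
      have := ((Real.hasDerivAt_sin (0 / T)).comp 0 ((hasDerivAt_id (0 : ℝ)).div_const T)).const_mul
        T
      simpa [hT.ne', Function.comp_def] using this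
    have h2 := HasDerivAt.scomp (0 : ℝ)
      (by simpa using hd 0 ⟨by linarith, hT.le⟩) h1
    rw [h0, chartLeft_idCoord] at h2
    refine HasDerivAt.congr_of_eventuallyEq (by simpa [Function.comp_def] using h2)
      (Eventually.of_forall fun t => ?_)
    exact (idChart E G).right_inv (hrt _ (hsin t))

end

/-! ### Closed subgroups of `H` containing all its curves -/

section

open Filter Topology Metric

variable {E : Type*} [NormedAddCommGroup E] [NormedSpace ℝ E]
  {G : Type*} [TopologicalSpace G] [ChartedSpace E G] [Group G] [LieGroup 𝓘(ℝ, E) ∞ G]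

/-- In the coset `S h` there is an element whose coordinate is, up to a factor `2`, as close to that
of the identity as possible. -/
theorem exists_almost_closest {S : Subgroup G} (hS : IsClosed (S : Set G)) {h : G}
    (hh : h ∈ (idChart E G).source) (hhS : h ∉ S) :
    ∃ a ∈ S, a * h ∈ (idChart E G).source ∧
      ‖idChart E G (a * h) - idCoord E G‖ ≤ 2 * ‖idChart E G h - idCoord E G‖ ∧
      ∀ b ∈ S, b * (a * h) ∈ (idChart E G).source →
        ‖idChart E G (a * h) - idCoord E G‖ ≤ 2 * ‖idChart E G (b * (a * h)) - idCoord E G‖ := by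
  have := topologicalGroup_of_lieGroup 𝓘(ℝ, E) ∞ (G := G)
  let D : Set ℝ := {d | ∃ a ∈ S, a * h ∈ (idChart E G).source ∧
    ‖idChart E G (a * h) - idCoord E G‖ = d}
  have hDh : ‖idChart E G h - idCoord E G‖ ∈ D := ⟨1, S.one_mem, by simpa using hh, by simp⟩
  have hDb : BddBelow D := ⟨0, by rintro _ ⟨a, -, -, rfl⟩; exact norm_nonneg _⟩
  -- The coset `S h` is closed and misses the identity, so it keeps a positive distance from it in
  -- the chart.
  obtain ⟨ρ, hρ, hρD⟩ : ∃ ρ > 0, ∀ d ∈ D, ρ ≤ d := by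
    have hcl : IsClosed ((fun g : G => g * h⁻¹) ⁻¹' (S : Set G)) :=
      hS.preimage (by fun_prop)
    have h1 : ((fun g : G => g * h⁻¹) ⁻¹' (S : Set G))ᶜ ∈ 𝓝 (1 : G) :=
      hcl.isOpen_compl.mem_nhds (by simpa using hhS)
    have h2 : ContinuousAt (idChart E G).symm (idCoord E G) :=
      (idChart E G).symm.continuousAt idCoord_mem_target
    rw [← symm_idCoord (E := E) (G := G)] at h1
    obtain ⟨ρ, hρ, hs⟩ := nhds_basis_ball.mem_iff.1 (h2.preimage_mem_nhds h1)
    refine ⟨ρ, hρ, ?_⟩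
    rintro _ ⟨a, ha, has, rfl⟩
    by_contra! hlt
    have h3 := hs (mem_ball_iff_norm.2 hlt)
    rw [Set.mem_preimage, (idChart E G).left_inv has] at h3
    exact h3 (by simpa using ha)
  have hpos : 0 < sInf D := lt_of_lt_of_le hρ (le_csInf ⟨_, hDh⟩ hρD)
  -- The infimum need not be attained; being positive, it is smaller than its double, whence the
  -- factor `2`.
  obtain ⟨_, ⟨a, ha, has, rfl⟩, hlt⟩ :=
    exists_lt_of_csInf_lt ⟨_, hDh⟩ (show sInf D < 2 * sInf D by linarith)
  refine ⟨a, ha, has, ?_, fun b hb hbs => ?_⟩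
  · linarith [csInf_le hDb hDh]
  · have : ‖idChart E G (b * (a * h)) - idCoord E G‖ ∈ D :=
      ⟨b * a, S.mul_mem hb ha, by rwa [mul_assoc], by rw [mul_assoc]⟩
    linarith [csInf_le hDb this]

variable [FiniteDimensional ℝ E]

/-- A closed subgroup of `H` which contains all smooth curves of `H` through the identity contains
a neighbourhood of the identity in `H`. -/
theorem eventually_mem_of_curves_mem {H S : Subgroup G} (hH : IsClosed (H : Set G))
    (hS : IsClosed (S : Set G)) (hSH : S ≤ H)
    (hc : ∀ γ : ℝ → G, ContMDiff 𝓘(ℝ, ℝ) 𝓘(ℝ, E) ∞ γ → (∀ t, γ t ∈ H) → γ 0 = 1 → ∀ t, γ t ∈ S) :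
    ∀ᶠ g in 𝓝 (1 : G), g ∈ H → g ∈ S := by
  have := topologicalGroup_of_lieGroup 𝓘(ℝ, E) ∞ (G := G)
  have := FiniteDimensional.proper_real E
  by_contra hcon
  have hfr : ∃ᶠ g in 𝓝 (1 : G), g ∈ (idChart E G).source ∧ g ∈ H ∧ g ∉ S := by
    rw [not_eventually] at hcon
    refine (hcon.and_eventually ((idChart E G).open_source.mem_nhds one_mem_source)).mono ?_
    intro g hg
    exact ⟨hg.2, Classical.not_imp.1 hg.1⟩
  have : (𝓝 (1 : G)).IsCountablyGenerated := by
    rw [← (idChart E G).symm_map_nhds_eq one_mem_source]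
    infer_instance
  obtain ⟨h, hh1, hh⟩ := exists_seq_forall_of_frequently hfr
  choose a ha has hle hmin using fun n => exists_almost_closest hS (hh n).1 (hh n).2.2
  have hkH : ∀ n, a n * h n ∈ H := fun n => H.mul_mem (hSH (ha n)) (hh n).2.1
  have hkS : ∀ n, a n * h n ∉ S := fun n hn => (hh n).2.2 ((S.mul_mem_cancel_left (ha n)).1 hn)
  generalize hk : (fun n => a n * h n) = k at *
  replace hk : ∀ n, a n * h n = k n := fun n => congrFun hk n
  simp only [hk] at has hle hmin hkH hkS
  have hρ : ∀ n, 0 < ‖idChart E G (k n) - idCoord E G‖ := by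
    intro n
    rw [norm_pos_iff, sub_ne_zero]
    intro he
    have h1 := (idChart E G).injOn (has n) one_mem_source he
    exact hkS n (h1 ▸ S.one_mem)
  have hρ0 : Tendsto (fun n => ‖idChart E G (k n) - idCoord E G‖) atTop (𝓝 0) := by
    refine squeeze_zero (fun n => norm_nonneg _) hle ?_
    have h1 : Tendsto (fun n => idChart E G (h n) - idCoord E G) atTop (𝓝 0) := by
      simpa using (tendsto_idChart (E := E) hh1).sub_const (idCoord E G)
    simpa using h1.norm.const_mul 2
  have hk1 : Tendsto k atTop (𝓝 1) := by
    have h1 : Tendsto (fun n => idChart E G (k n)) atTop (𝓝 (idCoord E G)) :=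
      tendsto_iff_norm_sub_tendsto_zero.2 hρ0
    have h2 := ((idChart E G).symm.continuousAt (idCoord_mem_target (E := E) (G := G))).tendsto.comp
      h1
    rw [symm_idCoord] at h2
    exact h2.congr fun n => (idChart E G).left_inv (has n)
  have hsphere : ∀ n, ‖idChart E G (k n) - idCoord E G‖⁻¹ • (idChart E G (k n) - idCoord E G) ∈
      sphere (0 : E) 1 := fun n => by
    rw [mem_sphere_zero_iff_norm, norm_smul, norm_inv, norm_norm, inv_mul_cancel₀ (hρ n).ne']
  -- The normalised directions of the almost closest elements `k n` subconverge by compactness of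
  -- the sphere. The limit `w` lies in `𝔥`, hence so does `-w`, and a curve `γ` in `H` with velocity
  -- `-w` lies in `S` by `hc`.
  obtain ⟨w, -, ψ, hψ, hw⟩ := (isCompact_sphere (0 : E) 1).tendsto_subseq hsphere
  have hψ' := hψ.tendsto_atTop
  have hwH : IsTangent H w := ⟨k ∘ ψ, fun n => ‖idChart E G (k (ψ n)) - idCoord E G‖,
    fun n => hkH _, fun n => hρ _, hρ0.comp hψ', hk1.comp hψ', hw⟩
  obtain ⟨γ, hγ, hγH, hγ0, hγd⟩ :=
    (mem_lieSubspace_iff H (-w)).1 (neg_mem (hwH.mem_lieSubspace hH))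
  have hγS := hc γ hγ hγH hγ0
  set ρ : ℕ → ℝ := fun n => ‖idChart E G (k (ψ n)) - idCoord E G‖ with hρdef
  have hρψ0 : Tendsto ρ atTop (𝓝 0) := hρ0.comp hψ'
  have hγ1 : Tendsto (fun n => γ (ρ n)) atTop (𝓝 1) := by
    have := (hγ 0).continuousAt.tendsto.comp hρψ0
    rwa [hγ0] at this
  have hγlim : Tendsto (fun n => (ρ n)⁻¹ • (idChart E G (γ (ρ n)) - idCoord E G)) atTop
      (𝓝 (-w)) := by
    have := hγd.hasFDerivAt.hasFDerivWithinAt (s := Set.univ).lim (c := fun n => (ρ n)⁻¹)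
      (d := ρ) (v := (1 : ℝ)) hρψ0 (by simp) (by
        refine tendsto_const_nhds.congr fun n => ?_
        simp [ρ, (hρ (ψ n)).ne'])
    simpa [hγ0] using this
  -- To first order `γ (ρ n) * k (ψ n)` has displacement `ρ n • (-w + w) = 0`, so its distance to
  -- the identity is `o(ρ n)`.
  have hmul := hasFDerivAt_chartMul (E := E) (G := G) |>.hasFDerivWithinAt (s := Set.univ) |>.lim
    (c := fun n => (ρ n)⁻¹)
    (d := fun n => (idChart E G (γ (ρ n)) - idCoord E G, idChart E G (k (ψ n)) - idCoord E G))
    (v := (-w, w)) (by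
      have h1 := (tendsto_idChart (E := E) hγ1).sub_const (idCoord E G)
      have h2 := (tendsto_idChart (E := E) (hk1.comp hψ')).sub_const (idCoord E G)
      rw [sub_self] at h1 h2
      exact h1.prodMk_nhds h2) (by simp) (hγlim.prodMk_nhds hw)
  -- But this product lies in the same `S`-coset as `k (ψ n)`, so almost minimality bounds its
  -- distance below by `ρ n / 2`. In the limit `1 ≤ 0`.
  have hev : ∀ᶠ n in atTop, (1 : ℝ) ≤ 2 * ‖(ρ n)⁻¹ • (Function.uncurry (chartMul (E := E) G)
      ((idCoord E G, idCoord E G) +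
        (idChart E G (γ (ρ n)) - idCoord E G, idChart E G (k (ψ n)) - idCoord E G)) -
      Function.uncurry (chartMul (E := E) G) (idCoord E G, idCoord E G))‖ := by
    have h1 : Tendsto (fun n => γ (ρ n) * k (ψ n)) atTop (𝓝 1) := by
      simpa using hγ1.mul (hk1.comp hψ')
    filter_upwards [eventually_mem_source (E := E) hγ1, eventually_mem_source (E := E) h1]
      with n hn1 hn2
    have h2 := hmin (ψ n) _ (hγS (ρ n)) hn2
    simp only [Prod.mk_add_mk, add_sub_cancel, Function.uncurry,
      chartMul_idCoord idCoord_mem_target]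
    rw [chartMul, (idChart E G).left_inv hn1, (idChart E G).left_inv (has _), norm_smul, norm_inv,
      Real.norm_of_nonneg (hρ (ψ n)).le]
    have h3 := mul_le_mul_of_nonneg_left h2 (inv_nonneg.2 (hρ (ψ n)).le)
    rw [inv_mul_cancel₀ (hρ (ψ n)).ne'] at h3
    linarith
  have hlim := hmul.norm.const_mul 2
  have := ge_of_tendsto hlim hev
  norm_num at this

/-- A subgroup containing a neighbourhood of the identity of `H` is open in `H`; being also closed,
it is all of the connected group `H`. -/
theorem le_of_curves_mem {H S : Subgroup G} (hH : IsClosed (H : Set G))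
    (hconn : IsConnected (H : Set G)) (hS : IsClosed (S : Set G)) (hSH : S ≤ H)
    (hc : ∀ γ : ℝ → G, ContMDiff 𝓘(ℝ, ℝ) 𝓘(ℝ, E) ∞ γ → (∀ t, γ t ∈ H) → γ 0 = 1 → ∀ t, γ t ∈ S) :
    H ≤ S := by
  have := topologicalGroup_of_lieGroup 𝓘(ℝ, E) ∞ (G := G)
  have : ConnectedSpace H := isConnected_iff_connectedSpace.1 hconn
  have hopen : IsOpen (S.subgroupOf H : Set H) := by
    refine Subgroup.isOpen_of_mem_nhds _ (g := 1) ?_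
    have h1 : Tendsto (Subtype.val : H → G) (𝓝 1) (𝓝 1) := continuous_subtype_val.tendsto 1
    filter_upwards [h1.eventually (eventually_mem_of_curves_mem hH hS hSH hc)] with g hg
    exact Subgroup.mem_subgroupOf.2 (hg g.2)
  have hclosed : IsClosed (S.subgroupOf H : Set H) := hS.preimage continuous_subtype_val
  have huniv := IsClopen.eq_univ ⟨hclosed, hopen⟩ ⟨1, (S.subgroupOf H).one_mem⟩
  intro g hg
  have : (⟨g, hg⟩ : H) ∈ (S.subgroupOf H : Set H) := huniv ▸ Set.mem_univ _
  exact this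

theorem adBivector_mem_iff (H : Subgroup G) (b : BivectorAt E (1 : G)) :
    (∀ x ∈ subgroupLieAlgebra (E := E) H,
      adBivector x b ∈ wedgeTop (subgroupLieAlgebra (E := E) H)) ↔
    ∀ x ∈ lieSubspace E H, derivationExt
      (fderiv ℝ (chartAd G) (idCoord E G) x).toLinearMap (coord 1 b) ∈
        wedgeTop (lieSubspace E H) := by
  simp only [mem_wedgeTop_iff_coord, coord_adBivector]
  constructor
  · rintro h _ ⟨x, hx, rfl⟩
    exact h x hx
  · exact fun h x hx => h _ (Submodule.mem_map_of_mem hx)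

end

end PoissonLie

end

theorem mainTheorem4 {E : Type*} [NormedAddCommGroup E] [NormedSpace ℝ E] [FiniteDimensional ℝ E]
    {G : Type*} [TopologicalSpace G] [ChartedSpace E G] [Group G] [LieGroup 𝓘(ℝ, E) ∞ G]
    (π : ∀ g : G, PoissonLie.BivectorAt E g) (hπ : PoissonLie.IsPoissonLie π)
    (H : Subgroup G) (hHclosed : IsClosed (H : Set G)) (hH : PoissonLie.IsCoisotropic π H) (σ : G) :
    (PoissonLie.IsCoisotropic (PoissonLie.translated π σ) H →
      ∀ x ∈ PoissonLie.subgroupLieAlgebra (E := E) H,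
        PoissonLie.adBivector x (PoissonLie.translationBivector π σ) ∈
          PoissonLie.wedgeTop (PoissonLie.subgroupLieAlgebra (E := E) H)) ∧
    (IsConnected (H : Set G) →
      (PoissonLie.IsCoisotropic (PoissonLie.translated π σ) H ↔
        ∀ x ∈ PoissonLie.subgroupLieAlgebra (E := E) H,
          PoissonLie.adBivector x (PoissonLie.translationBivector π σ) ∈
            PoissonLie.wedgeTop (PoissonLie.subgroupLieAlgebra (E := E) H))) := by
  rw [PoissonLie.adBivector_mem_iff, PoissonLie.isCoisotropic_translated_iff_le hπ hH]
  refine ⟨fun h x hx => PoissonLie.derivationExt_mem_of_le h hx, fun hconn =>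
    ⟨fun h x hx => PoissonLie.derivationExt_mem_of_le h hx, fun h => ?_⟩⟩
  exact PoissonLie.le_of_curves_mem hHclosed hconn
    (PoissonLie.isClosed_classStabilizer hHclosed _) (fun g hg => hg.1)
    fun γ hγ hγH h0 t => PoissonLie.curve_mem_classStabilizer h hγ hγH h0 t
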